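/- For real $x$ let $C(x)=\int_0^x\cos(\tfrac{\pi}{2}t^2)\,dt$ and $S(x)=\int_0^x\sin(\tfrac{\pi}{2}t^2)\,dt$ be the Fresnel integrals. For an integer $N\ge 1$ put $$A_N=\sqrt{(N+\tfrac12)\pi},\qquad t_k=\frac{(k-\frac12)\pi}{\sqrt{(N+\frac12)\pi}}\quad(k\ge 1),$$ $$F_N(x)=\frac12+\frac i2\tan\!\left(A_Nxe^{i\pi/4}\right)+\frac{x}{A_N}e^{i(x^2+\pi/4)}\sum_{k=1}^N\frac{e^{-t_k^2}}{x^2+it_k^2},$$ and define, for $x\in\mathbb R$, $$C_N(x)=\mathrm{Re}\left(\sqrt2\,e^{i\pi/4}\left(\tfrac12-F_N(\sqrt{\pi/2}\,x)\right)\right),\qquad S_N(x)=\mathrm{Im}\left(\sqrt2\,e^{i\pi/4}\left(\tfrac12-F_N(\sqrt{\pi/2}\,x)\right)\right).$$ With $\beta=1-\frac{\sqrt2}{2}-\frac{2\sqrt2+1}{16}$, let $$c_N=\frac{20\sqrt2\,e^{-\pi/2}}{9\pi(1-e^{-2A_N^2})}\left(1+2\sqrt\pi\,e^{-\beta A_N^2}\right)+\frac{(2\pi+1)e^{-\pi/2}}{2\sqrt2\,\pi^{3/2}A_N},$$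 $$\tilde c_N=\frac{8}{3\pi^{3/2}e^{\pi/2}(1-e^{-2A_N^2})}+\frac{2\pi+1}{\pi^2e^{\pi/2}A_N}.$$ Then the following hold for every integer $N\ge1$. (i) With $a_N(s)=s\sum_{k=1}^N\frac{e^{-t_k^2}}{s^2+t_k^4}$ and $b_N(s)=\sum_{k=1}^N\frac{t_k^2e^{-t_k^2}}{s^2+t_k^4}$, for all $x\in\mathbb R$, writing $m=\sqrt\pi A_Nx$ and $s=\frac\pi2x^2$, $$C_N(x)=\frac12\,\frac{\sinh m+\sin m}{\cos m+\cosh m}+\frac{\sqrt\pi\,x}{A_N}\bigl(a_N(s)\sin s-b_N(s)\cos s\bigr),$$ $$S_N(x)=\frac12\,\frac{\sinh m-\sin m}{\cos m+\cosh m}-\frac{\sqrt\pi\,x}{A_N}\bigl(a_N(s)\cos s+b_N(s)\sin s\bigr).$$ (ii) For all $x\in\mathbb R$, both $|C(x)-C_N(x)|$ and $|S(x)-S_N(x)|$ are at most $2c_N\dfrac{e^{-\pi N}}{\sqrt{2N+1}}$. (iii) For all real $x$ with $|x|\le\sqrt{N+1/2}$, both $|C(x)-C_N(x)|$ and $|S(x)-S_N(x)|$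 are at most $\sqrt\pi\,\tilde c_N\,|x|\,\dfrac{e^{-\pi N}}{2N+1}$. (iv) $0<c_N<0.83$ and $0<\tilde c_N<0.18$, and the sequences $(c_N)_{N\ge1}$ and $(\tilde c_N)_{N\ge1}$ are strictly decreasing. -/

import Mathlib

noncomputable section

namespace FresnelApprox

/-- The Fresnel cosine integral `C(x) = ∫₀ˣ cos(π t² / 2) dt`. -/
def fresnelC (x : ℝ) : ℝ := ∫ t in (0 : ℝ)..x, Real.cos (Real.pi / 2 * t ^ 2)

/-- The Fresnel sine integral `S(x) = ∫₀ˣ sin(π t² / 2) dt`. -/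
def fresnelS (x : ℝ) : ℝ := ∫ t in (0 : ℝ)..x, Real.sin (Real.pi / 2 * t ^ 2)

/-- The quadrature points `t_k = (k - 1/2) π / √((N + 1/2) π)`. -/
def node (N k : ℕ) : ℝ :=
  ((k : ℝ) - 1 / 2) * Real.pi / Real.sqrt (((N : ℝ) + 1 / 2) * Real.pi)

/-- `A_N = √((N + 1/2) π)`, which equals `t_{N+1}`. -/
def A (N : ℕ) : ℝ := Real.sqrt (((N : ℝ) + 1 / 2) * Real.pi)

/-- The modified trapezium rule approximation
`F_N(x) = 1/2 + (i/2) tan(A_N x e^{iπ/4})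
  + (x / A_N) e^{i(x² + π/4)} ∑_{k=1}^N e^{-t_k²} / (x² + i t_k²)`. -/
def F (N : ℕ) (x : ℝ) : ℂ :=
  1 / 2
    + Complex.I / 2
        * Complex.tan ((A N : ℂ) * (x : ℂ) * Complex.exp (Complex.I * (Real.pi : ℂ) / 4))
    + (x : ℂ) / (A N : ℂ)
        * Complex.exp (Complex.I * ((x : ℂ) ^ 2 + (Real.pi : ℂ) / 4))
        * ∑ k ∈ Finset.Icc 1 N,
            Complex.exp (-(node N k : ℂ) ^ 2)
              / ((x : ℂ) ^ 2 + Complex.I * (node N k : ℂ) ^ 2)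

/-- `√2 e^{iπ/4} (1/2 - F_N(√(π/2) x))`, whose real and imaginary parts are `C_N` and `S_N`. -/
def CS (N : ℕ) (x : ℝ) : ℂ :=
  (Real.sqrt 2 : ℂ) * Complex.exp (Complex.I * (Real.pi : ℂ) / 4)
    * (1 / 2 - F N (Real.sqrt (Real.pi / 2) * x))

/-- The approximation `C_N` to the Fresnel cosine integral. -/
def approxC (N : ℕ) (x : ℝ) : ℝ := (CS N x).re

/-- The approximation `S_N` to the Fresnel sine integral. -/
def approxS (N : ℕ) (x : ℝ) : ℝ := (CS N x).im

/-- `a_N(s) = s ∑_{k=1}^N e^{-t_k²} / (s² + t_k⁴)`. -/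
def a (N : ℕ) (s : ℝ) : ℝ :=
  s * ∑ k ∈ Finset.Icc 1 N, Real.exp (-(node N k) ^ 2) / (s ^ 2 + (node N k) ^ 4)

/-- `b_N(s) = ∑_{k=1}^N t_k² e^{-t_k²} / (s² + t_k⁴)`. -/
def b (N : ℕ) (s : ℝ) : ℝ :=
  ∑ k ∈ Finset.Icc 1 N,
    (node N k) ^ 2 * Real.exp (-(node N k) ^ 2) / (s ^ 2 + (node N k) ^ 4)

/-- The explicit formula for `C_N` in terms of real elementary functions. -/
def explicitC (N : ℕ) (x : ℝ) : ℝ :=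
  1 / 2
    * ((Real.sinh (Real.sqrt Real.pi * A N * x) + Real.sin (Real.sqrt Real.pi * A N * x))
      / (Real.cos (Real.sqrt Real.pi * A N * x) + Real.cosh (Real.sqrt Real.pi * A N * x)))
    + Real.sqrt Real.pi * x / A N
      * (a N (Real.pi / 2 * x ^ 2) * Real.sin (Real.pi / 2 * x ^ 2)
        - b N (Real.pi / 2 * x ^ 2) * Real.cos (Real.pi / 2 * x ^ 2))

/-- The explicit formula for `S_N` in terms of real elementary functions. -/
def explicitS (N : ℕ) (x : ℝ) : ℝ :=
  1 / 2
    * ((Real.sinh (Real.sqrt Real.pi * A N * x) - Real.sin (Real.sqrt Real.pi * A N * x))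
      / (Real.cos (Real.sqrt Real.pi * A N * x) + Real.cosh (Real.sqrt Real.pi * A N * x)))
    - Real.sqrt Real.pi * x / A N
      * (a N (Real.pi / 2 * x ^ 2) * Real.cos (Real.pi / 2 * x ^ 2)
        + b N (Real.pi / 2 * x ^ 2) * Real.sin (Real.pi / 2 * x ^ 2))

/-- `β = 1 - √2/2 - (2√2 + 1)/16 ≈ 0.0536`. -/
def beta : ℝ := 1 - Real.sqrt 2 / 2 - (2 * Real.sqrt 2 + 1) / 16

/-- The constant `c_N`. -/
def c (N : ℕ) : ℝ :=
  20 * Real.sqrt 2 * Real.exp (-Real.pi / 2)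
      / (9 * Real.pi * (1 - Real.exp (-2 * (A N) ^ 2)))
      * (1 + 2 * Real.sqrt Real.pi * Real.exp (-beta * (A N) ^ 2))
    + (2 * Real.pi + 1) * Real.exp (-Real.pi / 2)
      / (2 * Real.sqrt 2 * Real.pi ^ (3 / 2 : ℝ) * A N)

/-- The constant `c̃_N`. -/
def cTilde (N : ℕ) : ℝ :=
  8 / (3 * Real.pi ^ (3 / 2 : ℝ) * Real.exp (Real.pi / 2) * (1 - Real.exp (-2 * (A N) ^ 2)))
    + (2 * Real.pi + 1) / (Real.pi ^ 2 * Real.exp (Real.pi / 2) * A N)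

end FresnelApprox

end

open scoped Complex
open MeasureTheory

namespace FresnelApprox

/-! Put s = πx²/2 and w_m = t_m² - is, where t_m = (m + 1/2)π/A_N runs over all the half-integer
nodes. The Mittag-Leffler expansion of the tangent at a multiple of e^{iπ/4} turns the tangent term
of `CS` into (√π x/A_N) ∑ 1/w_m over all m ≥ 0. The finite sum in `F` subtracts e^{-w_m}/w_m for m <
N. Hence `CS N x` is (√π x/A_N) times the full sum of (1 - e^{-w_m})/w_m plus the tail of
e^{-w_m}/w_m over m ≥ N.

The full sum needs no contour integration. Each (1 - e^{-w})/w is ∫₀¹ 2u e^{-wu²} du, so summing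
over m under the integral gives a theta series at half-integers. Its modular transform
(`tsum_exp_neg_sq_halfNode`) gives an alternating series of integrals `oscInt (A² n²) s`, n ≥ 0. The
n = 0 term is exactly C(x) + iS(x); the others are the discretisation error. This is
`CS_sub_fresnel`.

Both errors are of size e^{-A_N²} = e^{-πN} e^{-π/2}. `oscInt B y` is at most e^{-B}/(2B) for every
y, and at most e^{-B}/y by parts; the tail is dominated by a geometric series. The error bounds
follow by choosing among these estimates. The explicit formulas are the real and imaginary parts of
`CS`, and monotonicity in N reduces the numerical bounds to N = 1. -/

/-! ### Partial fractions of the tangent -/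

open Complex in
/-- Mittag-Leffler expansion of the tangent. -/
theorem hasSum_tan_pi_mul {y : ℂ} (hy : y.im ≠ 0) :
    HasSum (fun m : ℕ ↦ 2 * y / (((m : ℂ) + 1 / 2) ^ 2 - y ^ 2))
      (Real.pi * Complex.tan (Real.pi * y)) := by
  have hmem : ∀ w : ℂ, w.im ≠ 0 → w ∈ Complex.integerComplement := by
    rintro w hw ⟨n, rfl⟩
    simp at hw
  have h2y : (2 * y).im ≠ 0 := by simpa using hy
  have h1 : HasSum (cotTerm y) (Real.pi * Complex.cot (Real.pi * y) - 1 / y) := by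
    rw [cot_series_rep' (hmem y hy)]
    exact (summable_cotTerm (hmem y hy)).hasSum
  have hs2 := summable_cotTerm (hmem _ h2y)
  have h2 : HasSum (cotTerm (2 * y))
      (Real.pi * Complex.cot (Real.pi * (2 * y)) - 1 / (2 * y)) := by
    rw [cot_series_rep' (hmem _ h2y)]
    exact hs2.hasSum
  have hev : Summable (fun m : ℕ ↦ cotTerm (2 * y) (2 * m)) :=
    hs2.comp_injective (mul_right_injective₀ (two_ne_zero))
  have hne : ∀ r : ℝ, y - r ≠ 0 := fun r h ↦ hy (by
    have := congrArg Complex.im h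
    simpa using this)
  have hne' : ∀ r : ℝ, y + r ≠ 0 := fun r h ↦ hy (by
    have := congrArg Complex.im h
    simpa using this)
  -- `cotTerm z n` has poles at ±(n + 1), so odd indices at 2y give the even integers, that is, half
  -- the cotangent series at y. The even indices leave the odd integers.
  have hodd : HasSum (fun m : ℕ ↦ cotTerm (2 * y) (2 * m + 1))
      (1 / 2 * (Real.pi * Complex.cot (Real.pi * y) - 1 / y)) := by
    refine (h1.mul_left (1 / 2)).congr_fun ?_
    intro m
    have e1 := hne (m + 1)
    have e2 := hne' (m + 1)
    push_cast at e1 e2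
    have e3 : 2 * y - (2 * m + 1 + 1) ≠ 0 := by
      rw [show 2 * y - (2 * m + 1 + 1) = 2 * (y - (m + 1)) by ring]
      exact mul_ne_zero two_ne_zero e1
    have e4 : 2 * y + (2 * m + 1 + 1) ≠ 0 := by
      rw [show 2 * y + (2 * m + 1 + 1) = 2 * (y + (m + 1)) by ring]
      exact mul_ne_zero two_ne_zero e2
    simp only [cotTerm]
    push_cast
    field_simp
    ring
  have key := (hev.hasSum.even_add_odd hodd).unique h2
  -- The 1/(2y) terms cancel, and cot 2θ - (cot θ)/2 = -(tan θ)/2.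
  have hval : ∑' m : ℕ, cotTerm (2 * y) (2 * m)
      = -(1 / 2) * (Real.pi * Complex.tan (Real.pi * y)) := by
    rw [eq_sub_of_add_eq key]
    have hs : Complex.sin (Real.pi * y) ≠ 0 := sin_pi_mul_ne_zero (hmem y hy)
    have hs' : Complex.sin (Real.pi * (2 * y)) ≠ 0 := sin_pi_mul_ne_zero (hmem _ h2y)
    have hd : (Real.pi : ℂ) * (2 * y) = 2 * (Real.pi * y) := by ring
    rw [hd, Complex.sin_two_mul] at hs'
    have hc : Complex.cos (Real.pi * y) ≠ 0 := fun h ↦ hs' (by rw [h, mul_zero])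
    have hy0 : y ≠ 0 := by simpa using hne 0
    rw [hd, Complex.cot, Complex.cot, Complex.tan, Complex.sin_two_mul, Complex.cos_two_mul']
    field_simp
    ring
  have hsum := (hval ▸ hev.hasSum).mul_left (-2)
  rw [show (-2 : ℂ) * (-(1 / 2) * (Real.pi * Complex.tan (Real.pi * y)))
    = Real.pi * Complex.tan (Real.pi * y) by ring] at hsum
  refine hsum.congr_fun ?_
  · intro m
    have e1 := hne ((m : ℝ) + 1 / 2)
    have e2 := hne' ((m : ℝ) + 1 / 2)
    push_cast at e1 e2
    have e3 : 2 * y - (2 * m + 1) ≠ 0 := by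
      rw [show 2 * y - (2 * m + 1) = 2 * (y - (m + 1 / 2)) by ring]
      exact mul_ne_zero two_ne_zero e1
    have e4 : 2 * y + (2 * m + 1) ≠ 0 := by
      rw [show 2 * y + (2 * m + 1) = 2 * (y + (m + 1 / 2)) by ring]
      exact mul_ne_zero two_ne_zero e2
    have e5 : ((m : ℂ) + 1 / 2) ^ 2 - y ^ 2 ≠ 0 := by
      rw [show ((m : ℂ) + 1 / 2) ^ 2 - y ^ 2 = -((y - (m + 1 / 2)) * (y + (m + 1 / 2))) by ring]
      exact neg_ne_zero.2 (mul_ne_zero e1 e2)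
    simp only [cotTerm]
    push_cast
    rw [one_div_add_one_div e3 e4, mul_div_assoc', div_eq_div_iff e5 (mul_ne_zero e3 e4)]
    ring

/-- The half-integer nodes with spacing `π / A`. -/
noncomputable def halfNode (A : ℝ) (m : ℕ) : ℝ := ((m : ℝ) + 1 / 2) * Real.pi / A

theorem halfNode_pos {A : ℝ} (hA : 0 < A) (m : ℕ) : 0 < halfNode A m := by
  unfold halfNode
  have := Real.pi_pos
  positivity

theorem hasSum_tan {A : ℝ} (hA : 0 < A) {z : ℂ} (hz : z.im ≠ 0) :
    HasSum (fun m : ℕ ↦ 2 * z / (A * ((halfNode A m : ℂ) ^ 2 - z ^ 2)))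
      (Complex.tan (A * z)) := by
  have hpi : (Real.pi : ℂ) ≠ 0 := by exact_mod_cast Real.pi_ne_zero
  have hA' : (A : ℂ) ≠ 0 := by exact_mod_cast hA.ne'
  have him : ((A : ℂ) * z / Real.pi).im ≠ 0 := by
    rw [show (A : ℂ) * z / Real.pi = ((A / Real.pi : ℝ) : ℂ) * z by push_cast; ring,
      Complex.im_ofReal_mul]
    exact mul_ne_zero (div_pos hA Real.pi_pos).ne' hz
  have h := (hasSum_tan_pi_mul him).mul_left (1 / (Real.pi : ℂ))
  rw [mul_div_cancel₀ _ hpi, ← mul_assoc, one_div_mul_cancel hpi, one_mul] at h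
  refine h.congr_fun ?_
  · intro m
    have : ((m : ℂ) + 1 / 2) ^ 2 - ((A : ℂ) * z / Real.pi) ^ 2
        = (A / Real.pi) ^ 2 * ((halfNode A m : ℂ) ^ 2 - z ^ 2) := by
      unfold halfNode
      push_cast
      field_simp
    rw [this]
    by_cases h0 : (halfNode A m : ℂ) ^ 2 - z ^ 2 = 0
    · simp [h0]
    · field_simp

/-! ### Theta function at half-integers -/

theorem summable_exp_neg_of_nat_le {r : ℕ → ℝ} {k : ℝ} (hk : 0 < k)
    (hr : ∀ n : ℕ, k * n ≤ r n) : Summable fun n : ℕ ↦ Real.exp (-r n) := by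
  refine Summable.of_nonneg_of_le (fun n ↦ (Real.exp_pos _).le) (fun n ↦ ?_)
    (Real.summable_exp_nat_mul_iff.2 (neg_lt_zero.2 hk))
  refine Real.exp_le_exp.2 ?_
  linarith [hr n]

/-- The modular transformation of the theta function at half-integer points. -/
theorem tsum_exp_neg_sq_halfNode {A u : ℝ} (hA : 0 < A) (hu : 0 < u) :
    ∑' m : ℕ, cexp (-((u : ℂ) ^ 2 * (halfNode A m : ℂ) ^ 2))
      = A / (√Real.pi * u) *
        (1 / 2 + ∑' n : ℕ, (-1) ^ (n + 1) *
          cexp (-((A : ℂ) ^ 2 * ((n : ℂ) + 1) ^ 2 / (u : ℂ) ^ 2))) := by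
  have hpi := Real.pi_pos
  have hpi' : (Real.pi : ℂ) ≠ 0 := by exact_mod_cast hpi.ne'
  have hA' : (A : ℂ) ≠ 0 := by exact_mod_cast hA.ne'
  have hu' : (u : ℂ) ≠ 0 := by exact_mod_cast hu.ne'
  set r : ℝ := A ^ 2 / (Real.pi * u ^ 2) with hr
  have hr0 : 0 < r := by positivity
  have hsqrt : (r : ℂ) ^ (1 / 2 : ℂ) = ((A / (√Real.pi * u) : ℝ) : ℂ) := by
    rw [show (1 / 2 : ℂ) = ((1 / 2 : ℝ) : ℂ) by push_cast; rfl, ← Complex.ofReal_cpow hr0.le,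
      ← Real.sqrt_eq_rpow, hr, Real.sqrt_div (by positivity), Real.sqrt_sq hA.le,
      Real.sqrt_mul hpi.le, Real.sqrt_sq hu.le]
  -- The parameter i/2 produces the sign (-1)^n on one side and, as i · i/2 = -1/2, the half-integer
  -- shift on the other.
  have key := Complex.tsum_exp_neg_quadratic (a := r) (by simpa using hr0) (Complex.I / 2)
  have hL : ∀ n : ℤ, cexp (-Real.pi * r * n ^ 2 + 2 * Real.pi * (Complex.I / 2) * n)
      = (-1) ^ n * cexp (-((A : ℂ) ^ 2 * (n : ℂ) ^ 2 / (u : ℂ) ^ 2)) := by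
    intro n
    rw [Complex.exp_add, mul_comm]
    congr 1
    · rw [show 2 * (Real.pi : ℂ) * (Complex.I / 2) * n = n * (Real.pi * Complex.I) by ring,
        Complex.exp_int_mul, Complex.exp_pi_mul_I]
    · congr 1
      rw [hr]
      push_cast
      field_simp
  have hR : ∀ n : ℤ, cexp (-Real.pi / r * (n + Complex.I * (Complex.I / 2)) ^ 2)
      = cexp (-((u : ℂ) ^ 2 * (((n : ℂ) - 1 / 2) * Real.pi / A) ^ 2)) := by
    intro n
    congr 1
    rw [show Complex.I * (Complex.I / 2) = -1 / 2 by linear_combination Complex.I_sq / 2, hr]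
    push_cast
    field_simp
    ring
  simp_rw [hL, hR] at key
  have hsL : Summable fun n : ℕ ↦ (-1 : ℂ) ^ (n + 1) *
      cexp (-((A : ℂ) ^ 2 * ((n : ℂ) + 1) ^ 2 / (u : ℂ) ^ 2)) := by
    refine Summable.of_norm ?_
    have : ∀ n : ℕ, ‖(-1 : ℂ) ^ (n + 1) * cexp (-((A : ℂ) ^ 2 * ((n : ℂ) + 1) ^ 2 / (u : ℂ) ^ 2))‖
        = Real.exp (-(A ^ 2 / u ^ 2 * ((n : ℝ) + 1) ^ 2)) := by
      intro n
      rw [show -((A : ℂ) ^ 2 * ((n : ℂ) + 1) ^ 2 / (u : ℂ) ^ 2)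
        = ((-(A ^ 2 / u ^ 2 * ((n : ℝ) + 1) ^ 2) : ℝ) : ℂ) by push_cast; ring]
      rw [norm_mul, norm_pow, norm_neg, norm_one, one_pow, one_mul, Complex.norm_exp,
        Complex.ofReal_re]
    simp_rw [this]
    refine summable_exp_neg_of_nat_le (k := A ^ 2 / u ^ 2) (by positivity) fun n ↦ ?_
    gcongr
    nlinarith [(n.cast_nonneg : (0 : ℝ) ≤ n)]
  have hsR : Summable fun m : ℕ ↦ cexp (-((u : ℂ) ^ 2 * (halfNode A m : ℂ) ^ 2)) := by
    refine Summable.of_norm ?_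
    have : ∀ m : ℕ, ‖cexp (-((u : ℂ) ^ 2 * (halfNode A m : ℂ) ^ 2))‖
        = Real.exp (-((u * Real.pi / A) ^ 2 * ((m : ℝ) + 1 / 2) ^ 2)) := by
      intro m
      rw [show -((u : ℂ) ^ 2 * (halfNode A m : ℂ) ^ 2)
        = ((-((u * Real.pi / A) ^ 2 * ((m : ℝ) + 1 / 2) ^ 2) : ℝ) : ℂ) by
          unfold halfNode; push_cast; ring]
      rw [Complex.norm_exp, Complex.ofReal_re]
    simp_rw [this]
    refine summable_exp_neg_of_nat_le (k := (u * Real.pi / A) ^ 2) (by positivity) fun n ↦ ?_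
    gcongr
    nlinarith [(n.cast_nonneg : (0 : ℝ) ≤ n)]
  have hpow : ∀ n : ℕ, (-1 : ℂ) ^ (-((n : ℤ) + 1)) = (-1) ^ (n + 1) := by
    intro n
    rw [zpow_neg, ← inv_zpow, inv_neg_one]
    exact_mod_cast zpow_natCast (-1 : ℂ) (n + 1)
  have sL := (HasSum.of_add_one_of_neg_add_one
    (f := fun n : ℤ ↦ (-1 : ℂ) ^ n * cexp (-((A : ℂ) ^ 2 * (n : ℂ) ^ 2 / (u : ℂ) ^ 2)))
    (hsL.hasSum.congr_fun fun n ↦ by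
      push_cast
      rw [show (-1 : ℂ) ^ ((n : ℤ) + 1) = (-1) ^ (n + 1) by
        rw [← zpow_natCast]; push_cast; rfl])
    (hsL.hasSum.congr_fun fun n ↦ by
      rw [hpow n]
      push_cast
      rw [neg_sq])).tsum_eq
  -- Index n + 1 gives node n, while -(n + 1) gives node n + 1 up to sign; index 0 supplies the
  -- missing node 0, so every node occurs twice.
  have sR := (HasSum.of_add_one_of_neg_add_one
    (f := fun n : ℤ ↦ cexp (-((u : ℂ) ^ 2 * (((n : ℂ) - 1 / 2) * Real.pi / A) ^ 2)))
    (hsR.hasSum.congr_fun fun n ↦ by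
      unfold halfNode
      push_cast
      ring_nf)
    ((hasSum_nat_add_iff' 1).2 hsR.hasSum |>.congr_fun fun n ↦ by
      unfold halfNode
      push_cast
      ring_nf)).tsum_eq
  rw [sL, sR, hsqrt] at key
  have h0 : cexp (-((u : ℂ) ^ 2 * ((((0 : ℤ) : ℂ) - 1 / 2) * Real.pi / A) ^ 2))
      = cexp (-((u : ℂ) ^ 2 * (halfNode A 0 : ℂ) ^ 2)) := by
    unfold halfNode
    push_cast
    ring_nf
  simp only [h0, Finset.range_one, Finset.sum_singleton] at key
  simp only [zpow_zero, Int.cast_zero, ne_eq, OfNat.ofNat_ne_zero, not_false_eq_true, zero_pow,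
    mul_zero, zero_div, neg_zero, Complex.exp_zero, mul_one] at key
  have hsp : (√Real.pi : ℂ) ≠ 0 := by exact_mod_cast (Real.sqrt_pos.2 hpi).ne'
  push_cast at key
  rw [div_mul_eq_mul_div, one_mul, eq_div_iff (by
    exact div_ne_zero hA' (mul_ne_zero hsp hu'))] at key
  linear_combination -(1 / 2 : ℂ) * key

/-! ### Oscillatory integrals -/

theorem integral_two_mul_exp_neg_sq {w : ℂ} (hw : w ≠ 0) :
    ∫ u in (0 : ℝ)..1, 2 * (u : ℂ) * cexp (-(w * (u : ℂ) ^ 2)) = (1 - cexp (-w)) / w := by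
  have hd : ∀ u : ℝ, HasDerivAt (fun u : ℝ ↦ -cexp (-(w * (u : ℂ) ^ 2)) / w)
      (2 * (u : ℂ) * cexp (-(w * (u : ℂ) ^ 2))) u := by
    intro u
    have h1 : HasDerivAt (fun z : ℂ ↦ -cexp (-(w * z ^ 2)) / w)
        (2 * (u : ℂ) * cexp (-(w * (u : ℂ) ^ 2))) (u : ℂ) := by
      have := (((((hasDerivAt_id (u : ℂ)).pow 2).const_mul w).neg.cexp).neg).div_const w
      refine this.congr_deriv ?_
      simp
      field_simp
    exact h1.comp_ofReal
  rw [intervalIntegral.integral_eq_sub_of_hasDerivAt (fun u _ ↦ hd u)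
    (Continuous.intervalIntegrable (by fun_prop) _ _)]
  simp
  ring

/-- The oscillatory Gaussian-type integral `∫₀¹ exp (i y u² - B / u²) du`. -/
noncomputable def oscInt (B y : ℝ) : ℂ :=
  ∫ u in (0 : ℝ)..1, cexp (Complex.I * y * (u : ℂ) ^ 2) * cexp (-((B : ℂ) / (u : ℂ) ^ 2))

theorem norm_exp_I_mul_mul (y u : ℝ) : ‖cexp (Complex.I * y * (u : ℂ) ^ 2)‖ = 1 := by
  rw [show Complex.I * y * (u : ℂ) ^ 2 = ((y * u ^ 2 : ℝ) : ℂ) * Complex.I by push_cast; ring,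
    Complex.norm_exp_ofReal_mul_I]

theorem norm_exp_neg_div_sq (B u : ℝ) :
    ‖cexp (-((B : ℂ) / (u : ℂ) ^ 2))‖ = Real.exp (-(B / u ^ 2)) := by
  rw [Complex.norm_exp]
  norm_cast

theorem oscInt_zero (y : ℝ) :
    oscInt 0 y = ∫ u in (0 : ℝ)..1, cexp (Complex.I * y * (u : ℂ) ^ 2) := by
  simp [oscInt]

/-- The convex function 1/u² lies above its tangent 1 + 2(1 - u) at u = 1; the gap is (u - 1)²(2u +
1)/u². The resulting majorant integrates in closed form. -/
theorem exp_neg_div_sq_le {B u : ℝ} (hB : 0 ≤ B) (hu : 0 < u) :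
    Real.exp (-(B / u ^ 2)) ≤ Real.exp (-B) * Real.exp (2 * B * (u - 1)) := by
  rw [← Real.exp_add]
  refine Real.exp_le_exp.2 ?_
  have h : 1 + 2 * (1 - u) ≤ 1 / u ^ 2 := by
    rw [le_div_iff₀ (by positivity)]
    nlinarith [mul_nonneg (sq_nonneg (u - 1)) (by linarith : (0 : ℝ) ≤ 2 * u + 1)]
  have := mul_le_mul_of_nonneg_left h hB
  rw [mul_one_div] at this
  linarith

theorem norm_oscInt_le {B : ℝ} (hB : 0 < B) (y : ℝ) :
    ‖oscInt B y‖ ≤ Real.exp (-B) / (2 * B) := by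
  have h1 : ‖oscInt B y‖ ≤ ∫ u in (0 : ℝ)..1, Real.exp (-B) * Real.exp (2 * B * (u - 1)) := by
    refine intervalIntegral.norm_integral_le_of_norm_le zero_le_one ?_
      (Continuous.intervalIntegrable (by fun_prop) _ _)
    refine Filter.Eventually.of_forall fun u hu ↦ ?_
    rw [norm_mul, norm_exp_I_mul_mul, one_mul, norm_exp_neg_div_sq]
    exact exp_neg_div_sq_le hB.le hu.1
  refine h1.trans ?_
  have hd : ∀ u : ℝ, HasDerivAt (fun u : ℝ ↦ Real.exp (-B) * (Real.exp (2 * B * (u - 1)) / (2 * B)))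
      (Real.exp (-B) * Real.exp (2 * B * (u - 1))) u := by
    intro u
    have := (((((hasDerivAt_id u).sub_const 1).const_mul (2 * B)).exp).div_const
      (2 * B)).const_mul (Real.exp (-B))
    refine this.congr_deriv ?_
    simp
    field_simp
  rw [intervalIntegral.integral_eq_sub_of_hasDerivAt (fun u _ ↦ hd u)
    (Continuous.intervalIntegrable (by fun_prop) _ _)]
  have : 0 ≤ Real.exp (-B) * (Real.exp (2 * B * (0 - 1)) / (2 * B)) := by positivity
  simp only [sub_self, mul_zero, Real.exp_zero]
  rw [mul_one_div]
  linarith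

theorem norm_oscInt_integrand_le_one {B : ℝ} (hB : 0 ≤ B) (y u : ℝ) :
    ‖cexp (Complex.I * y * (u : ℂ) ^ 2) * cexp (-((B : ℂ) / (u : ℂ) ^ 2))‖ ≤ 1 := by
  rw [norm_mul, norm_exp_I_mul_mul, one_mul, norm_exp_neg_div_sq]
  exact Real.exp_le_one_iff.2 (neg_nonpos.2 (by positivity))

theorem intervalIntegrable_oscInt_integrand {B : ℝ} (hB : 0 ≤ B) (y a b : ℝ) :
    IntervalIntegrable (fun u : ℝ ↦
      cexp (Complex.I * y * (u : ℂ) ^ 2) * cexp (-((B : ℂ) / (u : ℂ) ^ 2))) volume a b := by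
  refine (intervalIntegrable_const (c := (1 : ℝ))).mono_fun ?_ ?_
  · exact (Measurable.aestronglyMeasurable (by fun_prop))
  · refine Filter.Eventually.of_forall fun u ↦ ?_
    simpa using norm_oscInt_integrand_le_one hB y u

/-- Integration by parts against u e^{iyu²}, with amplitude φ(u) = e^{-B/u²}/u. As φ increases on
(0, 1] when 2B ≥ 1, the boundary terms and the variation add up to 2φ(1)/(2y). The cutoff ε avoids
the singular expressions at u = 0. -/
theorem norm_integral_oscInt_integrand_le {B y ε : ℝ} (hB : 1 / 2 ≤ B) (hy : 0 < y)
    (hε : 0 < ε) (hε1 : ε ≤ 1) :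
    ‖∫ u in ε..1, cexp (Complex.I * y * (u : ℂ) ^ 2) * cexp (-((B : ℂ) / (u : ℂ) ^ 2))‖
      ≤ Real.exp (-B) / y := by
  have hy' : (y : ℂ) ≠ 0 := by exact_mod_cast hy.ne'
  set φ : ℝ → ℝ := fun u ↦ Real.exp (-(B / u ^ 2)) / u with hφ
  set φ' : ℝ → ℝ := fun u ↦ Real.exp (-(B / u ^ 2)) * (2 * B / u ^ 4 - 1 / u ^ 2) with hφ'
  set v : ℝ → ℂ := fun u ↦ cexp (Complex.I * y * (u : ℂ) ^ 2) / (2 * Complex.I * y) with hv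
  have hI : Set.uIcc ε 1 = Set.Icc ε 1 := Set.uIcc_of_le hε1
  have hdφ : ∀ u ∈ Set.uIcc ε 1, HasDerivAt φ (φ' u) u := by
    intro u hu
    rw [hI] at hu
    have hu0 : u ≠ 0 := (hε.trans_le hu.1).ne'
    have h1 : HasDerivAt (fun u : ℝ ↦ -(B / u ^ 2)) (2 * B / u ^ 3) u := by
      have := ((hasDerivAt_const u B).div ((hasDerivAt_id u).pow 2) (pow_ne_zero 2 hu0)).neg
      refine this.congr_deriv ?_
      simp
      field_simp
    refine (h1.exp.div (hasDerivAt_id u) hu0).congr_deriv ?_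
    simp only [hφ', id]
    field_simp
  have hdv : ∀ u ∈ Set.uIcc ε 1,
      HasDerivAt v ((u : ℂ) * cexp (Complex.I * y * (u : ℂ) ^ 2)) u := by
    intro u _
    have h1 : HasDerivAt (fun z : ℂ ↦ cexp (Complex.I * y * z ^ 2) / (2 * Complex.I * y))
        ((u : ℂ) * cexp (Complex.I * y * (u : ℂ) ^ 2)) (u : ℂ) := by
      have := ((((hasDerivAt_id (u : ℂ)).pow 2).const_mul (Complex.I * y)).cexp).div_const
        (2 * Complex.I * y)
      refine this.congr_deriv ?_
      simp
      field_simp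
    exact h1.comp_ofReal
  have hcφ' : ContinuousOn φ' (Set.uIcc ε 1) := by
    have hne : ∀ k : ℕ, ∀ u ∈ Set.uIcc ε 1, u ^ k ≠ 0 := fun k u hu ↦
      pow_ne_zero _ (hε.trans_le (hI ▸ hu).1).ne'
    have h2 := hne 2
    have h4 := hne 4
    fun_prop (disch := assumption)
  have hiφ' : IntervalIntegrable φ' volume ε 1 := hcφ'.intervalIntegrable
  have hparts := intervalIntegral.integral_mul_deriv_eq_deriv_mul
    (u := fun u ↦ ((φ u : ℝ) : ℂ)) (u' := fun u ↦ ((φ' u : ℝ) : ℂ)) (v := v)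
    (fun u hu ↦ (hdφ u hu).ofReal_comp) hdv
    (Complex.continuous_ofReal.comp_continuousOn hcφ').intervalIntegrable
    (Continuous.intervalIntegrable (by fun_prop) _ _)
  have heq : ∫ u in ε..1, cexp (Complex.I * y * (u : ℂ) ^ 2) * cexp (-((B : ℂ) / (u : ℂ) ^ 2))
      = ∫ u in ε..1, ((φ u : ℝ) : ℂ) * ((u : ℂ) * cexp (Complex.I * y * (u : ℂ) ^ 2)) := by
    refine intervalIntegral.integral_congr fun u hu ↦ ?_
    rw [hI] at hu
    have hu0 : (u : ℂ) ≠ 0 := by exact_mod_cast (hε.trans_le hu.1).ne'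
    simp only [hφ]
    push_cast
    field_simp
  rw [heq, hparts]
  have hvn : ∀ u, ‖v u‖ = 1 / (2 * y) := by
    intro u
    simp only [hv]
    rw [norm_div, norm_exp_I_mul_mul]
    simp [abs_of_pos hy]
  have hφ0 : ∀ u, 0 < u → 0 ≤ φ u := fun u hu ↦ by simp only [hφ]; positivity
  have hφ'0 : ∀ u ∈ Set.Ioc ε 1, 0 ≤ φ' u := by
    intro u hu
    have hu0 : 0 < u := hε.trans hu.1
    have hu2 : u ^ 2 ≤ 1 := pow_le_one₀ hu0.le hu.2
    refine mul_nonneg (Real.exp_pos _).le ?_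
    rw [show 2 * B / u ^ 4 - 1 / u ^ 2 = (2 * B - u ^ 2) / u ^ 4 by field_simp]
    exact div_nonneg (by linarith) (by positivity)
  have hint : ‖∫ u in ε..1, ((φ' u : ℝ) : ℂ) * v u‖ ≤ (φ 1 - φ ε) * (1 / (2 * y)) := by
    have : ∫ u in ε..1, φ' u * (1 / (2 * y)) = (φ 1 - φ ε) * (1 / (2 * y)) := by
      rw [intervalIntegral.integral_mul_const,
        intervalIntegral.integral_eq_sub_of_hasDerivAt hdφ hiφ']
    rw [← this]
    refine intervalIntegral.norm_integral_le_of_norm_le hε1 ?_ (hiφ'.mul_const _)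
    refine Filter.Eventually.of_forall fun u hu ↦ ?_
    rw [norm_mul, hvn, Complex.norm_real, Real.norm_of_nonneg (hφ'0 u hu)]
  have hφ1 : φ 1 = Real.exp (-B) := by simp [hφ]
  calc ‖((φ 1 : ℝ) : ℂ) * v 1 - ((φ ε : ℝ) : ℂ) * v ε - ∫ u in ε..1, ((φ' u : ℝ) : ℂ) * v u‖
      ≤ ‖((φ 1 : ℝ) : ℂ) * v 1‖ + ‖((φ ε : ℝ) : ℂ) * v ε‖
        + ‖∫ u in ε..1, ((φ' u : ℝ) : ℂ) * v u‖ :=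
        (norm_sub_le _ _).trans (add_le_add_left (norm_sub_le _ _) _)
    _ ≤ φ 1 * (1 / (2 * y)) + φ ε * (1 / (2 * y)) + (φ 1 - φ ε) * (1 / (2 * y)) := by
        rw [norm_mul, norm_mul, hvn, hvn, Complex.norm_real, Complex.norm_real,
          Real.norm_of_nonneg (hφ0 1 one_pos), Real.norm_of_nonneg (hφ0 ε hε)]
        gcongr
    _ = Real.exp (-B) / y := by rw [hφ1]; field_simp; ring

theorem norm_oscInt_le_div {B y : ℝ} (hB : 1 / 2 ≤ B) (hy : 0 < y) :
    ‖oscInt B y‖ ≤ Real.exp (-B) / y := by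
  refine le_of_forall_pos_le_add fun δ hδ ↦ ?_
  -- The piece over [0, ε] has norm at most ε ≤ δ.
  set ε := min δ 1
  have hε : 0 < ε := lt_min hδ one_pos
  have hB0 : 0 ≤ B := by linarith
  rw [oscInt, ← intervalIntegral.integral_add_adjacent_intervals
    (intervalIntegrable_oscInt_integrand hB0 y 0 ε) (intervalIntegrable_oscInt_integrand hB0 y ε 1)]
  refine (norm_add_le _ _).trans ?_
  rw [add_comm]
  refine add_le_add (norm_integral_oscInt_integrand_le hB hy hε (min_le_right _ _)) ?_
  have := intervalIntegral.norm_integral_le_of_norm_le_const (a := 0) (b := ε) (C := 1)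
    (fun u _ ↦ norm_oscInt_integrand_le_one hB0 y u)
  rw [sub_zero, abs_of_pos hε, one_mul] at this
  exact this.trans (min_le_left _ _)

/-- From (n + 1)² ≥ 1 + 2n; the geometric ratio is the source of 1 - e^{-2A²} in both constants. -/
theorem exp_neg_mul_succ_sq_le (A : ℝ) (n : ℕ) :
    Real.exp (-(A ^ 2 * ((n : ℝ) + 1) ^ 2)) ≤ Real.exp (-A ^ 2) * Real.exp (-2 * A ^ 2) ^ n := by
  rw [← Real.exp_nat_mul, ← Real.exp_add]
  refine Real.exp_le_exp.2 ?_
  nlinarith [mul_nonneg (sq_nonneg A) (sq_nonneg (n : ℝ))]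

theorem norm_tsum_alternating_le {A K : ℝ} (hA : 0 < A) {J : ℕ → ℂ}
    (hJ : ∀ n : ℕ, ‖J n‖ ≤ K * Real.exp (-(A ^ 2 * ((n : ℝ) + 1) ^ 2))) :
    ‖∑' n : ℕ, (-1) ^ (n + 1) * J n‖ ≤ K * (Real.exp (-A ^ 2) / (1 - Real.exp (-2 * A ^ 2))) := by
  have hq : Real.exp (-2 * A ^ 2) < 1 := Real.exp_lt_one_iff.2 (by nlinarith [sq_pos_of_pos hA])
  have hK : 0 ≤ K := by
    by_contra h
    have h1 := (norm_nonneg _).trans (hJ 0)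
    exact absurd h1 (not_le.2 (mul_neg_of_neg_of_pos (not_le.1 h) (Real.exp_pos _)))
  have hg := ((hasSum_geometric_of_lt_one (Real.exp_pos _).le hq).mul_left
    (Real.exp (-A ^ 2))).mul_left K
  rw [div_eq_mul_inv]
  refine tsum_of_norm_bounded hg fun n ↦ ?_
  rw [norm_mul, norm_pow, norm_neg, norm_one, one_pow, one_mul]
  exact (hJ n).trans (mul_le_mul_of_nonneg_left (exp_neg_mul_succ_sq_le A n) hK)

theorem integral_two_mul_exp_neg_mul_sq_le {t : ℝ} (ht : 0 < t) :
    ∫ u in (0 : ℝ)..1, 2 * u * Real.exp (-(t * u ^ 2)) ≤ 1 / t := by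
  have hd : ∀ u : ℝ, HasDerivAt (fun u : ℝ ↦ -Real.exp (-(t * u ^ 2)) / t)
      (2 * u * Real.exp (-(t * u ^ 2))) u := by
    intro u
    have := (((((hasDerivAt_id u).pow 2).const_mul t).neg.exp).neg).div_const t
    refine this.congr_deriv ?_
    simp
    field_simp
  rw [intervalIntegral.integral_eq_sub_of_hasDerivAt (fun u _ ↦ hd u)
    (Continuous.intervalIntegrable (by fun_prop) _ _), ← sub_div]
  refine div_le_div_of_nonneg_right ?_ ht.le
  have := Real.exp_pos (-(t * 1 ^ 2))
  simp only [ne_eq, OfNat.ofNat_ne_zero, not_false_eq_true, zero_pow, mul_zero, neg_zero,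
    Real.exp_zero]
  linarith

/-! ### Summing the regularised series -/

theorem summable_one_div_halfNode_sq (A : ℝ) :
    Summable fun m : ℕ ↦ 1 / halfNode A m ^ 2 := by
  have h := ((summable_nat_add_iff 1).2
    (Real.summable_one_div_nat_pow.2 one_lt_two)).mul_left (4 * (A / Real.pi) ^ 2)
  refine Summable.of_nonneg_of_le (fun m ↦ by positivity) (fun m ↦ ?_) h
  have hpi := Real.pi_pos
  have hm : (0 : ℝ) ≤ m := m.cast_nonneg
  unfold halfNode
  push_cast
  rw [div_pow, one_div_div, div_pow, mul_one_div, mul_div_assoc', div_div,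
    div_le_div_iff₀ (by positivity) (by positivity)]
  nlinarith [mul_nonneg (mul_nonneg (sq_nonneg A) (sq_nonneg Real.pi))
    (by positivity : (0 : ℝ) ≤ m * (3 * m + 2))]

/-- The series whose terms are the regularised quadrature summands, evaluated by the modular
transformation of the theta function. -/
theorem hasSum_regularised {A : ℝ} (hA : 0 < A) (y : ℝ) :
    HasSum (fun m : ℕ ↦ (1 - cexp (-((halfNode A m : ℂ) ^ 2 - Complex.I * y)))
        / ((halfNode A m : ℂ) ^ 2 - Complex.I * y))
      (A / √Real.pi * (oscInt 0 y
        + 2 * ∑' n : ℕ, (-1) ^ (n + 1) * oscInt (A ^ 2 * ((n : ℝ) + 1) ^ 2) y)) := by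
  set w : ℕ → ℂ := fun m ↦ (halfNode A m : ℂ) ^ 2 - Complex.I * y with hw
  have hwre : ∀ m, (w m).re = halfNode A m ^ 2 := by
    intro m
    simp only [hw]
    rw [Complex.sub_re, ← Complex.ofReal_pow, Complex.ofReal_re]
    simp
  have hw0 : ∀ m, w m ≠ 0 := by
    intro m h
    have := hwre m
    rw [h] at this
    exact (pow_pos (halfNode_pos hA m) 2).ne this
  set F : ℕ → ℝ → ℂ := fun m u ↦ 2 * (u : ℂ) * cexp (-(w m * (u : ℂ) ^ 2)) with hF
  have hFn : ∀ m, ∀ u : ℝ, 0 ≤ u → ‖F m u‖ = 2 * u * Real.exp (-(halfNode A m ^ 2 * u ^ 2)) := by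
    intro m u hu
    simp only [hF]
    rw [norm_mul, norm_mul, Complex.norm_real, Complex.norm_ofNat, Real.norm_of_nonneg hu,
      Complex.norm_exp, Complex.neg_re, ← Complex.ofReal_pow, Complex.re_mul_ofReal, hwre]
  have hFi : ∀ m, Integrable (F m) (volume.restrict (Set.Ioc 0 1)) := by
    intro m
    have : Continuous (F m) := by simp only [hF]; fun_prop
    exact (this.integrableOn_Icc (a := 0) (b := 1)).mono_set Set.Ioc_subset_Icc_self
  -- The L¹ norms are at most 1/t_m², which justifies exchanging sum and integral.
  have hFs : Summable fun m ↦ ∫ u in Set.Ioc (0 : ℝ) 1, ‖F m u‖ := by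
    refine Summable.of_nonneg_of_le (fun m ↦ integral_nonneg fun _ ↦ norm_nonneg _) (fun m ↦ ?_)
      (summable_one_div_halfNode_sq A)
    refine le_of_eq_of_le ?_ (integral_two_mul_exp_neg_mul_sq_le (pow_pos (halfNode_pos hA m) 2))
    rw [intervalIntegral.integral_of_le zero_le_one]
    exact setIntegral_congr_fun measurableSet_Ioc fun u hu ↦ hFn m u hu.1.le
  have h1 := hasSum_integral_of_summable_integral_norm hFi hFs
  have h1' : ∀ m, ∫ u in Set.Ioc (0 : ℝ) 1, F m u = (1 - cexp (-w m)) / w m := by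
    intro m
    rw [← intervalIntegral.integral_of_le zero_le_one]
    exact integral_two_mul_exp_neg_sq (hw0 m)
  simp_rw [h1'] at h1
  -- Coefficients of the two-sided alternating series folded onto n ≥ 0, keeping main term and
  -- corrections in one series.
  set c : ℕ → ℂ := fun n ↦ if n = 0 then 1 else 2 * (-1) ^ n with hc
  have hcn : ∀ n, ‖c n‖ ≤ 2 := by
    intro n
    simp only [hc]
    split_ifs <;> simp
  set g : ℕ → ℝ → ℂ := fun n u ↦
    cexp (Complex.I * y * (u : ℂ) ^ 2) * cexp (-(((A ^ 2 * (n : ℝ) ^ 2 : ℝ) : ℂ) / (u : ℂ) ^ 2))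
    with hg
  have hgi : ∀ n, IntervalIntegrable (g n) volume 0 1 := fun n ↦
    intervalIntegrable_oscInt_integrand (by positivity) y 0 1
  set G : ℕ → ℝ → ℂ := fun n u ↦ c n * g n u with hG
  have hGi : ∀ n, Integrable (G n) (volume.restrict (Set.Ioc 0 1)) := fun n ↦
    (((hgi n).1).const_mul (c n))
  have hGb : ∀ n, ∀ u ∈ Set.Ioc (0 : ℝ) 1, ‖G n u‖ ≤ 2 * Real.exp (-(A ^ 2 * (n : ℝ) ^ 2)) := by
    intro n u hu
    simp only [hG, hg]
    rw [norm_mul, norm_mul, norm_exp_I_mul_mul, one_mul, norm_exp_neg_div_sq]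
    refine mul_le_mul (hcn n) ?_ (Real.exp_pos _).le zero_le_two
    refine Real.exp_le_exp.2 (neg_le_neg ?_)
    rw [le_div_iff₀ (pow_pos hu.1 2)]
    exact mul_le_of_le_one_right (by positivity) (pow_le_one₀ hu.1.le hu.2)
  have hbs : Summable fun n : ℕ ↦ 2 * Real.exp (-(A ^ 2 * (n : ℝ) ^ 2)) := by
    refine (summable_exp_neg_of_nat_le (k := A ^ 2) (by positivity) fun n ↦ ?_).mul_left 2
    gcongr
    exact_mod_cast Nat.le_self_pow two_ne_zero n
  have hGs : Summable fun n ↦ ∫ u in Set.Ioc (0 : ℝ) 1, ‖G n u‖ := by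
    refine Summable.of_nonneg_of_le (fun n ↦ integral_nonneg fun _ ↦ norm_nonneg _) (fun n ↦ ?_) hbs
    have := setIntegral_mono_on (hGi n).norm (integrableOn_const (by simp)) measurableSet_Ioc
      (hGb n)
    simpa using this
  have h2 := hasSum_integral_of_summable_integral_norm hGi hGs
  have h2' : ∀ n, ∫ u in Set.Ioc (0 : ℝ) 1, G n u = c n * oscInt (A ^ 2 * (n : ℝ) ^ 2) y := by
    intro n
    rw [← intervalIntegral.integral_of_le zero_le_one]
    exact intervalIntegral.integral_const_mul _ _
  simp_rw [h2'] at h2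
  -- The weight 2u cancels the factor 1/u of the theta transformation.
  have hpt : ∀ u ∈ Set.Ioc (0 : ℝ) 1, ∑' m, F m u = A / √Real.pi * ∑' n, G n u := by
    intro u hu
    have hu' : (u : ℂ) ≠ 0 := by exact_mod_cast hu.1.ne'
    have hsp : (√Real.pi : ℂ) ≠ 0 := by exact_mod_cast (Real.sqrt_pos.2 Real.pi_pos).ne'
    have hFu : ∀ m, F m u = 2 * (u : ℂ) * cexp (Complex.I * y * (u : ℂ) ^ 2)
        * cexp (-((u : ℂ) ^ 2 * (halfNode A m : ℂ) ^ 2)) := by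
      intro m
      simp only [hF, hw]
      rw [mul_assoc (2 * (u : ℂ)), ← Complex.exp_add]
      ring_nf
    have hGu : Summable fun n ↦ G n u := Summable.of_norm_bounded hbs fun n ↦ hGb n u hu
    have hGu1 : ∀ n : ℕ, G (n + 1) u = 2 * cexp (Complex.I * y * (u : ℂ) ^ 2) * ((-1) ^ (n + 1) *
          cexp (-((A : ℂ) ^ 2 * ((n : ℂ) + 1) ^ 2 / (u : ℂ) ^ 2))) := by
      intro n
      simp only [hG, hg, hc, if_neg (Nat.succ_ne_zero n)]
      push_cast
      ring
    have hGu0 : G 0 u = cexp (Complex.I * y * (u : ℂ) ^ 2) := by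
      simp [hG, hg, hc]
    rw [hGu.tsum_eq_zero_add, hGu0]
    simp_rw [hFu, hGu1]
    rw [tsum_mul_left, tsum_mul_left, tsum_exp_neg_sq_halfNode hA hu.1]
    field_simp
  rw [setIntegral_congr_fun measurableSet_Ioc hpt, integral_const_mul] at h1
  have h3 := (hasSum_nat_add_iff' 1).2 h2
  have h3' : ∀ n : ℕ, c (n + 1) * oscInt (A ^ 2 * ((n + 1 : ℕ) : ℝ) ^ 2) y
      = 2 * ((-1) ^ (n + 1) * oscInt (A ^ 2 * ((n : ℝ) + 1) ^ 2) y) := by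
    intro n
    simp only [hc, if_neg (Nat.succ_ne_zero n)]
    push_cast
    ring
  simp_rw [h3'] at h3
  have hval : oscInt 0 y + 2 * ∑' n : ℕ, (-1) ^ (n + 1) * oscInt (A ^ 2 * ((n : ℝ) + 1) ^ 2) y
      = ∫ u in Set.Ioc (0 : ℝ) 1, ∑' n, G n u := by
    rw [← tsum_mul_left, h3.tsum_eq]
    simp [hc]
  rw [hval]
  exact h1

/-! ### The error identity -/

theorem A_pos (N : ℕ) : 0 < A N := by
  unfold A
  have := Real.pi_pos
  positivity

theorem A_sq (N : ℕ) : A N ^ 2 = ((N : ℝ) + 1 / 2) * Real.pi := by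
  unfold A
  have := Real.pi_pos
  exact Real.sq_sqrt (by positivity)

theorem node_succ (N m : ℕ) : node N (m + 1) = halfNode (A N) m := by
  unfold node halfNode A
  push_cast
  ring

theorem sqrt_two_mul_exp_pi_div_four :
    (√2 : ℂ) * cexp (Complex.I * Real.pi / 4) = 1 + Complex.I := by
  rw [show Complex.I * Real.pi / 4 = ((Real.pi / 4 : ℝ) : ℂ) * Complex.I by push_cast; ring,
    Complex.exp_mul_I, ← Complex.ofReal_cos, ← Complex.ofReal_sin, Real.cos_pi_div_four,
    Real.sin_pi_div_four]
  have h : (√2 : ℂ) * √2 = 2 := by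
    exact_mod_cast Real.mul_self_sqrt (by norm_num : (0 : ℝ) ≤ 2)
  push_cast
  linear_combination (1 / 2 + Complex.I / 2) * h

theorem exp_pi_div_four_sq : cexp (Complex.I * Real.pi / 4) ^ 2 = Complex.I := by
  rw [← Complex.exp_nat_mul,
    show ((2 : ℕ) : ℂ) * (Complex.I * Real.pi / 4) = Real.pi / 2 * Complex.I by push_cast; ring,
    Complex.exp_pi_div_two_mul_I]

theorem sqrt_two_mul_sqrt_pi_div_two : √2 * √(Real.pi / 2) = √Real.pi := by
  rw [← Real.sqrt_mul zero_le_two, mul_div_cancel₀ _ two_ne_zero]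

theorem sq_sqrt_pi_div_two_mul (x : ℝ) : (√(Real.pi / 2) * x) ^ 2 = Real.pi / 2 * x ^ 2 := by
  rw [mul_pow, Real.sq_sqrt (by have := Real.pi_pos; positivity)]

theorem CS_eq (N : ℕ) (x : ℝ) :
    CS N x = -(Complex.I * (1 + Complex.I) / 2) * Complex.tan
        ((A N : ℂ) * (√(Real.pi / 2) * x : ℝ) * cexp (Complex.I * Real.pi / 4))
      - Complex.I * (√Real.pi * x / A N : ℝ)
        * cexp (Complex.I * (Real.pi / 2 * x ^ 2 : ℝ))
        * ∑ m ∈ Finset.range N, cexp (-(halfNode (A N) m : ℂ) ^ 2)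
          / ((Real.pi / 2 * x ^ 2 : ℝ) + Complex.I * (halfNode (A N) m : ℂ) ^ 2) := by
  have hsum : ∑ k ∈ Finset.Icc 1 N, cexp (-(node N k : ℂ) ^ 2)
        / (((√(Real.pi / 2) * x : ℝ) : ℂ) ^ 2 + Complex.I * (node N k : ℂ) ^ 2)
      = ∑ m ∈ Finset.range N, cexp (-(halfNode (A N) m : ℂ) ^ 2)
          / ((Real.pi / 2 * x ^ 2 : ℝ) + Complex.I * (halfNode (A N) m : ℂ) ^ 2) := by
    rw [← Complex.ofReal_pow, sq_sqrt_pi_div_two_mul, Finset.range_eq_Ico,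
      ← Finset.Ico_add_one_right_eq_Icc, Finset.sum_Ico_eq_sum_range, add_tsub_cancel_right,
      ← Finset.range_eq_Ico]
    simp_rw [add_comm 1, node_succ]
  have he : cexp (Complex.I * (((√(Real.pi / 2) * x : ℝ) : ℂ) ^ 2 + Real.pi / 4))
      = cexp (Complex.I * (Real.pi / 2 * x ^ 2 : ℝ)) * cexp (Complex.I * Real.pi / 4) := by
    rw [← Complex.ofReal_pow, sq_sqrt_pi_div_two_mul, ← Complex.exp_add]
    ring_nf
  have h1 := sqrt_two_mul_exp_pi_div_four
  have h2 : ((√2 : ℝ) : ℂ) * (√(Real.pi / 2) : ℝ) = (√Real.pi : ℝ) := by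
    exact_mod_cast sqrt_two_mul_sqrt_pi_div_two
  have h4 := exp_pi_div_four_sq
  unfold CS F
  rw [hsum, he]
  set T := Complex.tan ((A N : ℂ) * (√(Real.pi / 2) * x : ℝ) * cexp (Complex.I * Real.pi / 4))
  set S := ∑ m ∈ Finset.range N, cexp (-(halfNode (A N) m : ℂ) ^ 2)
          / ((Real.pi / 2 * x ^ 2 : ℝ) + Complex.I * (halfNode (A N) m : ℂ) ^ 2)
  set E := cexp (Complex.I * (Real.pi / 2 * x ^ 2 : ℝ))
  set W := cexp (Complex.I * Real.pi / 4)
  push_cast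
  rw [← h2]
  linear_combination (-(Complex.I / 2) * T) * h1
    - ((√2 : ℝ) : ℂ) * (√(Real.pi / 2) : ℝ) * x / A N * E * S * h4

theorem add_I_mul_sq_eq (s t : ℝ) :
    (s : ℂ) + Complex.I * (t : ℂ) ^ 2 = Complex.I * ((t : ℂ) ^ 2 - Complex.I * s) := by
  linear_combination (s : ℂ) * Complex.I_sq

theorem sq_sub_I_mul_ne_zero {t : ℝ} (ht : 0 < t) (s : ℝ) : (t : ℂ) ^ 2 - Complex.I * s ≠ 0 := by
  intro h
  have := congrArg Complex.re h
  rw [← Complex.ofReal_pow, Complex.sub_re, Complex.ofReal_re] at this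
  simp at this
  exact ht.ne' this

theorem norm_sq_sub_I_mul (t s : ℝ) : ‖(t : ℂ) ^ 2 - Complex.I * s‖ = √(t ^ 4 + s ^ 2) := by
  rw [show (t : ℂ) ^ 2 - Complex.I * s = ((t ^ 2 : ℝ) : ℂ) + ((-s : ℝ) : ℂ) * Complex.I by
    push_cast; ring, Complex.norm_add_mul_I]
  ring_nf

/-- Substitute t = xu; this identifies the n = 0 term of the transformed series. -/
theorem fresnel_eq_mul_oscInt (x : ℝ) :
    (fresnelC x : ℂ) + fresnelS x * Complex.I = x * oscInt 0 (Real.pi / 2 * x ^ 2) := by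
  have h0 : ∀ t : ℝ, cexp (Complex.I * (Real.pi / 2 * t ^ 2 : ℝ))
      = ((Real.cos (Real.pi / 2 * t ^ 2) : ℝ) : ℂ)
        + ((Real.sin (Real.pi / 2 * t ^ 2) : ℝ) : ℂ) * Complex.I := by
    intro t
    rw [mul_comm Complex.I, Complex.exp_mul_I, Complex.ofReal_cos, Complex.ofReal_sin]
  have h1 := intervalIntegral.smul_integral_comp_mul_left (a := (0 : ℝ)) (b := 1)
    (fun t : ℝ ↦ cexp (Complex.I * (Real.pi / 2 * t ^ 2 : ℝ))) x
  rw [mul_zero, mul_one] at h1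
  rw [oscInt_zero]
  have h2 : ∀ u : ℝ, cexp (Complex.I * (Real.pi / 2 * (x * u) ^ 2 : ℝ))
      = cexp (Complex.I * (Real.pi / 2 * x ^ 2 : ℝ) * (u : ℂ) ^ 2) := by
    intro u
    push_cast
    ring_nf
  simp_rw [h2] at h1
  rw [Complex.real_smul] at h1
  rw [h1]
  simp_rw [h0]
  rw [intervalIntegral.integral_add (Continuous.intervalIntegrable (by fun_prop) _ _)
    (Continuous.intervalIntegrable (by fun_prop) _ _), intervalIntegral.integral_mul_const,
    intervalIntegral.integral_ofReal, intervalIntegral.integral_ofReal]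
  rfl

/-- The tangent expansion at z = √(π/2) x e^{iπ/4}, where z² = is makes the denominators t_m² - is.
It requires z off the real axis, hence x ≠ 0. -/
theorem hasSum_tan_term (N : ℕ) {x : ℝ} (hx : x ≠ 0) :
    HasSum (fun m : ℕ ↦ (√Real.pi * x / A N : ℂ)
        * (1 / ((halfNode (A N) m : ℂ) ^ 2 - Complex.I * (Real.pi / 2 * x ^ 2 : ℝ))))
      (-(Complex.I * (1 + Complex.I) / 2) * Complex.tan
        ((A N : ℂ) * (√(Real.pi / 2) * x : ℝ) * cexp (Complex.I * Real.pi / 4))) := by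
  set s : ℝ := Real.pi / 2 * x ^ 2 with hs
  set X : ℝ := √(Real.pi / 2) * x with hX
  have hA := A_pos N
  have hA' : (A N : ℂ) ≠ 0 := by exact_mod_cast hA.ne'
  have hX0 : X ≠ 0 := mul_ne_zero (Real.sqrt_pos.2 (div_pos Real.pi_pos two_pos)).ne' hx
  have hXs : X ^ 2 = s := sq_sqrt_pi_div_two_mul x
  have h2 : ((√2 : ℝ) : ℂ) * X = (√Real.pi : ℝ) * x := by
    rw [hX, ← sqrt_two_mul_sqrt_pi_div_two]
    push_cast
    ring
  have h1 := sqrt_two_mul_exp_pi_div_four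
  have h4 := exp_pi_div_four_sq
  set W := cexp (Complex.I * Real.pi / 4) with hW
  have hWim : W.im ≠ 0 := by
    have : √2 * W.im = 1 := by
      have := congrArg Complex.im h1
      rw [Complex.im_ofReal_mul] at this
      simpa using this
    exact right_ne_zero_of_mul_eq_one this
  have hz : ((X : ℂ) * W).im ≠ 0 := by
    rw [Complex.im_ofReal_mul]
    exact mul_ne_zero hX0 hWim
  have htan := hasSum_tan hA hz
  rw [← mul_assoc] at htan
  have hz2 : ((X : ℂ) * W) ^ 2 = Complex.I * s := by
    rw [mul_pow, h4, ← hXs]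
    push_cast
    ring
  rw [hz2] at htan
  have htan' := (htan.mul_left (-(Complex.I * (1 + Complex.I) / 2)))
  rw [← mul_assoc (A N : ℂ)] at htan'
  refine htan'.congr_fun fun m ↦ ?_
  have hm := sq_sub_I_mul_ne_zero (halfNode_pos hA m) s
  rw [← h2, ← h1]
  field_simp
  linear_combination (Complex.I * h4 + Complex.I_sq) * X

/-- Subtract the regularised series from the tangent series: 1/w - (1 - e^{-w})/w = e^{-w}/w. -/
theorem hasSum_regularised_remainder (N : ℕ) {x : ℝ} (hx : x ≠ 0) :
    HasSum (fun m : ℕ ↦ (√Real.pi * x / A N : ℂ)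
        * (cexp (-((halfNode (A N) m : ℂ) ^ 2 - Complex.I * (Real.pi / 2 * x ^ 2 : ℝ)))
          / ((halfNode (A N) m : ℂ) ^ 2 - Complex.I * (Real.pi / 2 * x ^ 2 : ℝ))))
      (-(Complex.I * (1 + Complex.I) / 2) * Complex.tan
        ((A N : ℂ) * (√(Real.pi / 2) * x : ℝ) * cexp (Complex.I * Real.pi / 4))
        - x * (oscInt 0 (Real.pi / 2 * x ^ 2) + 2 * ∑' n : ℕ, (-1) ^ (n + 1) *
          oscInt (A N ^ 2 * ((n : ℝ) + 1) ^ 2) (Real.pi / 2 * x ^ 2))) := by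
  have hA' : (A N : ℂ) ≠ 0 := by exact_mod_cast (A_pos N).ne'
  have hsp : (√Real.pi : ℂ) ≠ 0 := by exact_mod_cast (Real.sqrt_pos.2 Real.pi_pos).ne'
  have hreg := (hasSum_regularised (A_pos N) (Real.pi / 2 * x ^ 2)).mul_left
    (√Real.pi * x / A N : ℂ)
  rw [← mul_assoc, show (√Real.pi * x / A N : ℂ) * (A N / √Real.pi) = x by field_simp] at hreg
  refine ((hasSum_tan_term N hx).sub hreg).congr_fun fun m ↦ ?_
  ring

/-- The quadrature error, split into the discretisation error of the full modified trapezium rule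
and the truncated tail. -/
theorem CS_sub_fresnel (N : ℕ) (x : ℝ) :
    CS N x - ((fresnelC x : ℂ) + fresnelS x * Complex.I)
      = x * (2 * ∑' n : ℕ, (-1) ^ (n + 1) *
          oscInt (A N ^ 2 * ((n : ℝ) + 1) ^ 2) (Real.pi / 2 * x ^ 2))
        + (√Real.pi * x / A N : ℝ) * ∑' j : ℕ,
          cexp (-((halfNode (A N) (j + N) : ℂ) ^ 2 - Complex.I * (Real.pi / 2 * x ^ 2 : ℝ)))
          / ((halfNode (A N) (j + N) : ℂ) ^ 2 - Complex.I * (Real.pi / 2 * x ^ 2 : ℝ)) := by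
  rw [fresnel_eq_mul_oscInt, CS_eq]
  rcases eq_or_ne x 0 with rfl | hx
  · simp
  have hfin : Complex.I * (√Real.pi * x / A N : ℝ) * cexp (Complex.I * (Real.pi / 2 * x ^ 2 : ℝ))
        * ∑ m ∈ Finset.range N, cexp (-(halfNode (A N) m : ℂ) ^ 2)
          / ((Real.pi / 2 * x ^ 2 : ℝ) + Complex.I * (halfNode (A N) m : ℂ) ^ 2)
      = ∑ m ∈ Finset.range N, (√Real.pi * x / A N : ℂ)
        * (cexp (-((halfNode (A N) m : ℂ) ^ 2 - Complex.I * (Real.pi / 2 * x ^ 2 : ℝ)))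
          / ((halfNode (A N) m : ℂ) ^ 2 - Complex.I * (Real.pi / 2 * x ^ 2 : ℝ))) := by
    rw [Finset.mul_sum]
    refine Finset.sum_congr rfl fun m _ ↦ ?_
    generalize (Real.pi / 2 * x ^ 2 : ℝ) = s
    have hm := sq_sub_I_mul_ne_zero (halfNode_pos (A_pos N) m) s
    have hI := Complex.I_ne_zero
    have hA' : (A N : ℂ) ≠ 0 := by exact_mod_cast (A_pos N).ne'
    rw [add_I_mul_sq_eq, neg_sub, sub_eq_add_neg (Complex.I * (s : ℂ)), Complex.exp_add]
    push_cast
    field_simp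
  -- The first N terms are those of the finite sum in `F`; removing them leaves the truncation tail.
  have htail := ((hasSum_nat_add_iff' N).2 (hasSum_regularised_remainder N hx)).tsum_eq
  rw [tsum_mul_left] at htail
  rw [hfin]
  push_cast at htail ⊢
  linear_combination -htail

/-! ### Error bounds -/

/-- A_N² = (N + 1/2)π places the first omitted node exactly at A_N, so truncation and discretisation
errors both carry e^{-A_N²}. -/
theorem halfNode_add (N j : ℕ) : halfNode (A N) (j + N) = A N + j * (Real.pi / A N) := by
  have h := A_sq N
  have hA := (A_pos N).ne'
  unfold halfNode
  push_cast
  field_simp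
  linarith

theorem A_le_halfNode_add (N j : ℕ) : A N ≤ halfNode (A N) (j + N) := by
  rw [halfNode_add]
  have := A_pos N
  have := Real.pi_pos
  exact le_add_of_nonneg_right (by positivity)

theorem exp_neg_halfNode_add_sq_le (N j : ℕ) :
    Real.exp (-halfNode (A N) (j + N) ^ 2)
      ≤ Real.exp (-A N ^ 2) * Real.exp (-2 * Real.pi) ^ j := by
  rw [← Real.exp_nat_mul, ← Real.exp_add, halfNode_add]
  refine Real.exp_le_exp.2 ?_
  have hA := (A_pos N).ne'
  have h : A N * (j * (Real.pi / A N)) = j * Real.pi := by field_simp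
  nlinarith [sq_nonneg ((j : ℝ) * (Real.pi / A N))]

/-- From e^{2π} ≥ 1 + 2π; this is where the factor 2π + 1 in the constants arises. -/
theorem inv_one_sub_exp_neg_two_pi_le :
    (1 - Real.exp (-2 * Real.pi))⁻¹ ≤ (2 * Real.pi + 1) / (2 * Real.pi) := by
  have hpi := Real.pi_pos
  have h1 := Real.add_one_le_exp (2 * Real.pi)
  have h2 : Real.exp (-2 * Real.pi) ≤ (2 * Real.pi + 1)⁻¹ := by
    rw [neg_mul, Real.exp_neg]
    exact inv_anti₀ (by positivity) h1
  rw [← inv_div]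
  refine inv_anti₀ (by positivity) ?_
  have : 2 * Real.pi / (2 * Real.pi + 1) = 1 - (2 * Real.pi + 1)⁻¹ := by
    field_simp
    ring
  linarith

/-- W is left free: A_N² suits the bound linear in |x|, and √π |x| A_N the uniform one. -/
theorem norm_tsum_tail_le (N : ℕ) {s W : ℝ} (hW : 0 < W)
    (h : ∀ j : ℕ, W ≤ ‖(halfNode (A N) (j + N) : ℂ) ^ 2 - Complex.I * s‖) :
    ‖∑' j : ℕ, cexp (-((halfNode (A N) (j + N) : ℂ) ^ 2 - Complex.I * s))
        / ((halfNode (A N) (j + N) : ℂ) ^ 2 - Complex.I * s)‖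
      ≤ Real.exp (-A N ^ 2) / W * ((2 * Real.pi + 1) / (2 * Real.pi)) := by
  have hq : Real.exp (-2 * Real.pi) < 1 := Real.exp_lt_one_iff.2 (by linarith [Real.pi_pos])
  have hg := (hasSum_geometric_of_lt_one (Real.exp_pos _).le hq).mul_left
    (Real.exp (-A N ^ 2) / W)
  refine (tsum_of_norm_bounded hg fun j ↦ ?_).trans
    (mul_le_mul_of_nonneg_left inv_one_sub_exp_neg_two_pi_le (by positivity))
  rw [norm_div, Complex.norm_exp, Complex.neg_re, ← Complex.ofReal_pow, Complex.sub_re,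
    Complex.ofReal_re]
  have : (Complex.I * (s : ℂ)).re = 0 := by simp
  rw [this, sub_zero, Complex.ofReal_pow, div_mul_eq_mul_div]
  exact div_le_div₀ (by positivity) (exp_neg_halfNode_add_sq_le N j) hW (h j)

theorem half_le_mul_succ_sq (N n : ℕ) : 1 / 2 ≤ A N ^ 2 * ((n : ℝ) + 1) ^ 2 := by
  rw [A_sq]
  have h1 : (1 : ℝ) ≤ ((n : ℝ) + 1) ^ 2 := one_le_pow₀ (by linarith [(n.cast_nonneg : (0:ℝ) ≤ n)])
  have h2 : (1 / 2 : ℝ) ≤ ((N : ℝ) + 1 / 2) * Real.pi := by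
    nlinarith [Real.pi_gt_three, (N.cast_nonneg : (0 : ℝ) ≤ N)]
  nlinarith

theorem norm_discretisation_le (N : ℕ) (y : ℝ) :
    ‖∑' n : ℕ, (-1) ^ (n + 1) * oscInt (A N ^ 2 * ((n : ℝ) + 1) ^ 2) y‖
      ≤ 1 / (2 * A N ^ 2) * (Real.exp (-A N ^ 2) / (1 - Real.exp (-2 * A N ^ 2))) := by
  have hA := A_pos N
  refine norm_tsum_alternating_le hA fun n ↦ (norm_oscInt_le (by positivity) y).trans ?_
  rw [one_div_mul_eq_div]
  refine div_le_div_of_nonneg_left (Real.exp_pos _).le (by positivity) ?_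
  have h1 : (1 : ℝ) ≤ ((n : ℝ) + 1) ^ 2 := one_le_pow₀ (by linarith [(n.cast_nonneg : (0:ℝ) ≤ n)])
  nlinarith [sq_nonneg (A N)]

theorem norm_discretisation_le_div (N : ℕ) {y : ℝ} (hy : 0 < y) :
    ‖∑' n : ℕ, (-1) ^ (n + 1) * oscInt (A N ^ 2 * ((n : ℝ) + 1) ^ 2) y‖
      ≤ 1 / y * (Real.exp (-A N ^ 2) / (1 - Real.exp (-2 * A N ^ 2))) := by
  refine norm_tsum_alternating_le (A_pos N) fun n ↦
    (norm_oscInt_le_div (half_le_mul_succ_sq N n) hy).trans ?_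
  rw [one_div_mul_eq_div]

theorem one_sub_exp_neg_pos (N : ℕ) : 0 < 1 - Real.exp (-2 * A N ^ 2) :=
  sub_pos.2 (Real.exp_lt_one_iff.2 (by nlinarith [sq_pos_of_pos (A_pos N)]))

/-- Discretisation error, uniformly in `x`. -/
theorem abs_mul_norm_discretisation_le (N : ℕ) (x : ℝ) :
    |x| * (2 * ‖∑' n : ℕ, (-1) ^ (n + 1) *
        oscInt (A N ^ 2 * ((n : ℝ) + 1) ^ 2) (Real.pi / 2 * x ^ 2)‖)
      ≤ 4 / (Real.pi * A N) * (Real.exp (-A N ^ 2) / (1 - Real.exp (-2 * A N ^ 2))) := by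
  have hA := A_pos N
  have hpi := Real.pi_pos
  have hR : 0 ≤ Real.exp (-A N ^ 2) / (1 - Real.exp (-2 * A N ^ 2)) :=
    div_nonneg (Real.exp_pos _).le (one_sub_exp_neg_pos N).le
  -- For |x| ≤ A_N the y-free bound gives |x|/A_N² ≤ 1/A_N, and π < 4; beyond, the by-parts bound
  -- gives 4/(π|x|).
  rcases le_total |x| (A N) with h | h
  · calc _ ≤ |x| * (2 * (1 / (2 * A N ^ 2) *
          (Real.exp (-A N ^ 2) / (1 - Real.exp (-2 * A N ^ 2))))) := by
          gcongr
          exact norm_discretisation_le N _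
      _ = |x| / A N ^ 2 * (Real.exp (-A N ^ 2) / (1 - Real.exp (-2 * A N ^ 2))) := by
          field_simp
      _ ≤ _ := by
          refine mul_le_mul_of_nonneg_right ?_ hR
          rw [div_le_div_iff₀ (by positivity) (by positivity)]
          have : |x| * Real.pi ≤ 4 * A N := by
            nlinarith [Real.pi_lt_four, abs_nonneg x]
          nlinarith
  · have hx : 0 < |x| := hA.trans_le h
    have hy : 0 < Real.pi / 2 * x ^ 2 := by
      rw [← sq_abs]
      positivity
    calc _ ≤ |x| * (2 * (1 / (Real.pi / 2 * x ^ 2) *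
          (Real.exp (-A N ^ 2) / (1 - Real.exp (-2 * A N ^ 2))))) := by
          gcongr
          exact norm_discretisation_le_div N hy
      _ = 4 / (Real.pi * |x|) * (Real.exp (-A N ^ 2) / (1 - Real.exp (-2 * A N ^ 2))) := by
          rw [← sq_abs]
          field_simp
          ring
      _ ≤ _ := by gcongr

theorem norm_CS_sub_fresnel_le (N : ℕ) (x : ℝ) :
    ‖CS N x - ((fresnelC x : ℂ) + fresnelS x * Complex.I)‖
      ≤ |x| * (2 * ‖∑' n : ℕ, (-1) ^ (n + 1) *
          oscInt (A N ^ 2 * ((n : ℝ) + 1) ^ 2) (Real.pi / 2 * x ^ 2)‖)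
        + √Real.pi * |x| / A N * ‖∑' j : ℕ,
          cexp (-((halfNode (A N) (j + N) : ℂ) ^ 2 - Complex.I * (Real.pi / 2 * x ^ 2 : ℝ)))
          / ((halfNode (A N) (j + N) : ℂ) ^ 2 - Complex.I * (Real.pi / 2 * x ^ 2 : ℝ))‖ := by
  rw [CS_sub_fresnel]
  refine (norm_add_le _ _).trans (le_of_eq ?_)
  rw [norm_mul, norm_mul, norm_mul, Complex.norm_real, Complex.norm_real, Complex.norm_ofNat,
    norm_div, norm_mul, Real.norm_eq_abs, Real.norm_eq_abs, Real.norm_eq_abs,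
    abs_of_pos (A_pos N), abs_of_pos (Real.sqrt_pos.2 Real.pi_pos)]

theorem exp_neg_pi_mul (N : ℕ) :
    Real.exp (-Real.pi * N) = Real.exp (-A N ^ 2) * Real.exp (Real.pi / 2) := by
  rw [← Real.exp_add, A_sq]
  ring_nf

theorem two_mul_add_one_eq (N : ℕ) : 2 * (N : ℝ) + 1 = 2 * A N ^ 2 / Real.pi := by
  rw [A_sq]
  have := Real.pi_pos
  field_simp

theorem pi_rpow_three_halves : Real.pi ^ (3 / 2 : ℝ) = Real.pi * √Real.pi := by
  rw [show (3 / 2 : ℝ) = 1 + 1 / 2 by norm_num, Real.rpow_add Real.pi_pos, Real.rpow_one,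
    Real.sqrt_eq_rpow]

theorem norm_CS_sub_fresnel_le_cTilde (N : ℕ) (x : ℝ) :
    ‖CS N x - ((fresnelC x : ℂ) + fresnelS x * Complex.I)‖
      ≤ √Real.pi * cTilde N * |x| * (Real.exp (-Real.pi * N) / (2 * N + 1)) := by
  have hA := A_pos N
  have hpi := Real.pi_pos
  have hD := one_sub_exp_neg_pos N
  have hsp := Real.sqrt_pos.2 hpi
  have htail := norm_tsum_tail_le N (s := Real.pi / 2 * x ^ 2) (pow_pos hA 2) fun j ↦ by
    rw [norm_sq_sub_I_mul]
    refine Real.le_sqrt_of_sq_le ?_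
    have h4 := pow_le_pow_left₀ hA.le (A_le_halfNode_add N j) 4
    nlinarith [sq_nonneg (Real.pi / 2 * x ^ 2)]
  refine (norm_CS_sub_fresnel_le N x).trans ?_
  calc _ ≤ |x| * (2 * (1 / (2 * A N ^ 2) *
            (Real.exp (-A N ^ 2) / (1 - Real.exp (-2 * A N ^ 2)))))
          + √Real.pi * |x| / A N *
            (Real.exp (-A N ^ 2) / A N ^ 2 * ((2 * Real.pi + 1) / (2 * Real.pi))) := by
        gcongr
        exact norm_discretisation_le N _
    -- The estimate gives 1/A_N²; 4/3 is slack that matches the 8/3 of `cTilde`.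
    _ ≤ |x| * (4 / (3 * A N ^ 2) * (Real.exp (-A N ^ 2) / (1 - Real.exp (-2 * A N ^ 2))))
          + √Real.pi * |x| / A N *
            (Real.exp (-A N ^ 2) / A N ^ 2 * ((2 * Real.pi + 1) / (2 * Real.pi))) := by
        rw [← mul_assoc 2]
        gcongr ?_ * (?_ * ?_) + _
        rw [mul_one_div, div_le_div_iff₀ (by positivity) (by positivity)]
        nlinarith [sq_pos_of_pos hA]
    _ = _ := by
        unfold cTilde
        rw [exp_neg_pi_mul, two_mul_add_one_eq, pi_rpow_three_halves]
        have hE := Real.exp_pos (Real.pi / 2)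
        field_simp
        ring

/-- AM-GM: t⁴ + s² ≥ 2t²s = πx²t², and t ≥ A_N. The factor |x| then cancels the prefactor of the
tail. -/
theorem sqrt_pi_mul_abs_mul_A_le_norm (N j : ℕ) (x : ℝ) :
    √Real.pi * |x| * A N ≤ ‖(halfNode (A N) (j + N) : ℂ) ^ 2
      - Complex.I * (Real.pi / 2 * x ^ 2 : ℝ)‖ := by
  have hA := A_pos N
  have hpi := Real.pi_pos
  rw [norm_sq_sub_I_mul]
  refine Real.le_sqrt_of_sq_le ?_
  rw [mul_pow, mul_pow, Real.sq_sqrt hpi.le, sq_abs]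
  have h2 := pow_le_pow_left₀ hA.le (A_le_halfNode_add N j) 2
  have h3 := mul_le_mul_of_nonneg_left h2 (by positivity : 0 ≤ Real.pi * x ^ 2)
  nlinarith [sq_nonneg (halfNode (A N) (j + N) ^ 2 - Real.pi / 2 * x ^ 2)]

theorem beta_pos : 0 < beta := by
  unfold beta
  have h : √2 < 1.415 := by
    rw [Real.sqrt_lt' (by norm_num)]
    norm_num
  linarith

theorem norm_CS_sub_fresnel_le_c (N : ℕ) (x : ℝ) :
    ‖CS N x - ((fresnelC x : ℂ) + fresnelS x * Complex.I)‖
      ≤ 2 * c N * (Real.exp (-Real.pi * N) / √(2 * N + 1)) := by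
  have hA := A_pos N
  have hpi := Real.pi_pos
  have hD := one_sub_exp_neg_pos N
  have hsp := Real.sqrt_pos.2 hpi
  have hsp2 := Real.sq_sqrt hpi.le
  have hs2 := Real.sqrt_pos.2 (zero_lt_two' ℝ)
  have hs22 := Real.sq_sqrt (zero_le_two (α := ℝ))
  have hE := Real.exp_pos (Real.pi / 2)
  have htail : √Real.pi * |x| / A N * ‖∑' j : ℕ,
          cexp (-((halfNode (A N) (j + N) : ℂ) ^ 2 - Complex.I * (Real.pi / 2 * x ^ 2 : ℝ)))
          / ((halfNode (A N) (j + N) : ℂ) ^ 2 - Complex.I * (Real.pi / 2 * x ^ 2 : ℝ))‖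
      ≤ Real.exp (-A N ^ 2) / A N ^ 2 * ((2 * Real.pi + 1) / (2 * Real.pi)) := by
    rcases eq_or_ne x 0 with rfl | hx
    · simp only [abs_zero, mul_zero, zero_div, zero_mul]
      positivity
    · have hx' := abs_pos.2 hx
      calc _ ≤ √Real.pi * |x| / A N * (Real.exp (-A N ^ 2) / (√Real.pi * |x| * A N)
              * ((2 * Real.pi + 1) / (2 * Real.pi))) := by
            gcongr
            exact norm_tsum_tail_le N (by positivity) fun j ↦ sqrt_pi_mul_abs_mul_A_le_norm N j x
        _ = _ := by field_simp
  refine (norm_CS_sub_fresnel_le N x).trans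
    ((add_le_add (abs_mul_norm_discretisation_le N x) htail).trans ?_)
  have hsqrt : √(2 * (N : ℝ) + 1) = √2 * A N / √Real.pi := by
    rw [two_mul_add_one_eq, Real.sqrt_div (by positivity), Real.sqrt_mul zero_le_two,
      Real.sqrt_sq hA.le]
  have hexp : Real.exp (-Real.pi / 2) = (Real.exp (Real.pi / 2))⁻¹ := by
    rw [neg_div, Real.exp_neg]
  -- Only √π ≤ π and 4 ≤ 40/9 are needed; the factor involving `beta` exceeds 1. The tail matches
  -- the second summand of `c` exactly.
  have hmain : 4 / (Real.pi * A N) ≤ 40 / (9 * √Real.pi * A N)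
      * (1 + 2 * √Real.pi * Real.exp (-beta * A N ^ 2)) := by
    have h1 : 4 / (Real.pi * A N) ≤ 40 / (9 * √Real.pi * A N) := by
      rw [div_le_div_iff₀ (by positivity) (by positivity)]
      have h2 : √Real.pi ≤ Real.pi := by
        rw [Real.sqrt_le_left hpi.le]
        nlinarith [Real.pi_gt_three]
      nlinarith [mul_le_mul_of_nonneg_right h2 hA.le, mul_pos hpi hA]
    refine h1.trans (le_mul_of_one_le_right (by positivity) ?_)
    exact le_add_of_nonneg_right (by positivity)
  have hR : 0 ≤ Real.exp (-A N ^ 2) / (1 - Real.exp (-2 * A N ^ 2)) := by positivity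
  refine (add_le_add_left (mul_le_mul_of_nonneg_right hmain hR) _).trans (le_of_eq ?_)
  unfold c
  rw [exp_neg_pi_mul, hsqrt, pi_rpow_three_halves, hexp]
  generalize Real.exp (-beta * A N ^ 2) = b
  generalize 1 - Real.exp (-2 * A N ^ 2) = d at hD
  generalize √Real.pi = p at hsp hsp2
  rw [← hsp2]
  field_simp
  linear_combination (9 * d * (2 * p ^ 2 + 1)) * hs22

theorem abs_fresnelC_sub_le (N : ℕ) (x : ℝ) :
    |fresnelC x - approxC N x| ≤ ‖CS N x - ((fresnelC x : ℂ) + fresnelS x * Complex.I)‖ := by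
  have := Complex.abs_re_le_norm (CS N x - ((fresnelC x : ℂ) + fresnelS x * Complex.I))
  rw [abs_sub_comm]
  simpa [approxC] using this

theorem abs_fresnelS_sub_le (N : ℕ) (x : ℝ) :
    |fresnelS x - approxS N x| ≤ ‖CS N x - ((fresnelC x : ℂ) + fresnelS x * Complex.I)‖ := by
  have := Complex.abs_im_le_norm (CS N x - ((fresnelC x : ℂ) + fresnelS x * Complex.I))
  rw [abs_sub_comm]
  simpa [approxS] using this

/-! ### Explicit real formulas -/

theorem cos_add_cosh_pos (m : ℝ) : 0 < Real.cos m + Real.cosh m := by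
  rcases eq_or_ne m 0 with rfl | hm
  · simp
  · linarith [Real.neg_one_le_cos m, Real.one_lt_cosh.2 hm]

/-- Multiply numerator and denominator by 2 cos z', z' the conjugate of z, and use product-to-sum
with z + z' = m, z - z' = im. -/
theorem tan_half_mul_one_add_I (m : ℝ) :
    Complex.tan ((m / 2 : ℝ) * (1 + Complex.I))
      = ((Real.sin m : ℝ) + (Real.sinh m : ℝ) * Complex.I)
        / ((Real.cos m + Real.cosh m : ℝ) : ℂ) := by
  set z : ℂ := (m / 2 : ℝ) * (1 + Complex.I) with hz
  set z' : ℂ := (m / 2 : ℝ) * (1 - Complex.I) with hz'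
  have hadd : z + z' = m := by simp only [hz, hz']; push_cast; ring
  have hsub : z - z' = m * Complex.I := by simp only [hz, hz']; push_cast; ring
  have h1 : 2 * (Complex.cos z * Complex.cos z') = ((Real.cos m + Real.cosh m : ℝ) : ℂ) := by
    push_cast
    rw [← Complex.cos_mul_I, ← hsub, ← hadd, Complex.cos_add, Complex.cos_sub]
    ring
  have h2 : 2 * (Complex.sin z * Complex.cos z')
      = (Real.sin m : ℝ) + (Real.sinh m : ℝ) * Complex.I := by
    push_cast
    rw [← Complex.sin_mul_I, ← hsub, ← hadd, Complex.sin_add, Complex.sin_sub]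
    ring
  have h0 : ((Real.cos m + Real.cosh m : ℝ) : ℂ) ≠ 0 := by
    exact_mod_cast (cos_add_cosh_pos m).ne'
  rw [← h1] at h0
  have hc' : Complex.cos z' ≠ 0 := (mul_ne_zero_iff.1 (mul_ne_zero_iff.1 h0).2).2
  rw [← h1, ← h2, Complex.tan, mul_div_mul_left _ _ two_ne_zero, mul_div_mul_right _ _ hc']

theorem sum_eq_a_sub_b (N : ℕ) (s : ℝ) :
    ∑ m ∈ Finset.range N, cexp (-(halfNode (A N) m : ℂ) ^ 2)
          / (s + Complex.I * (halfNode (A N) m : ℂ) ^ 2)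
      = (a N s : ℂ) - Complex.I * b N s := by
  unfold a b
  rw [← Finset.Ico_add_one_right_eq_Icc, Finset.sum_Ico_eq_sum_range, Finset.sum_Ico_eq_sum_range,
    add_tsub_cancel_right]
  simp_rw [add_comm 1, node_succ]
  push_cast
  rw [Finset.mul_sum, Finset.mul_sum, ← Finset.sum_sub_distrib]
  refine Finset.sum_congr rfl fun m _ ↦ ?_
  have hm := sq_sub_I_mul_ne_zero (halfNode_pos (A_pos N) m) s
  have h1 : (s : ℂ) + Complex.I * (halfNode (A N) m : ℂ) ^ 2 ≠ 0 := by
    rw [add_I_mul_sq_eq]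
    exact mul_ne_zero Complex.I_ne_zero hm
  have h2 : (s : ℂ) ^ 2 + (halfNode (A N) m : ℂ) ^ 4 ≠ 0 := by
    have := halfNode_pos (A_pos N) m
    have h : s ^ 2 + halfNode (A N) m ^ 4 ≠ 0 := by positivity
    exact_mod_cast h
  rw [mul_div_assoc', mul_div_assoc', ← sub_div, div_eq_div_iff h1 h2]
  linear_combination (cexp (-(halfNode (A N) m : ℂ) ^ 2)) * (halfNode (A N) m : ℂ) ^ 4
    * Complex.I_sq

theorem CS_eq_explicit (N : ℕ) (x : ℝ) :
    CS N x = (explicitC N x : ℂ) + explicitS N x * Complex.I := by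
  have harg : (A N : ℂ) * (√(Real.pi / 2) * x : ℝ) * cexp (Complex.I * Real.pi / 4)
      = ((√Real.pi * A N * x / 2 : ℝ) : ℂ) * (1 + Complex.I) := by
    rw [← sqrt_two_mul_exp_pi_div_four, ← sqrt_two_mul_sqrt_pi_div_two]
    have h3 : ((√2 : ℝ) : ℂ) * (√2 : ℝ) = 2 := by
      exact_mod_cast Real.mul_self_sqrt (by norm_num : (0 : ℝ) ≤ 2)
    push_cast
    linear_combination -(A N * (√(Real.pi / 2) : ℝ) * x * cexp (Complex.I * Real.pi / 4) / 2 : ℂ)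
      * h3
  rw [CS_eq, harg, tan_half_mul_one_add_I, sum_eq_a_sub_b,
    mul_comm Complex.I ((Real.pi / 2 * x ^ 2 : ℝ) : ℂ),
    Complex.exp_mul_I, ← Complex.ofReal_cos, ← Complex.ofReal_sin]
  unfold explicitC explicitS
  generalize Real.pi / 2 * x ^ 2 = s
  generalize √Real.pi * A N * x = m
  have h0 : ((Real.cos m + Real.cosh m : ℝ) : ℂ) ≠ 0 := by
    exact_mod_cast (cos_add_cosh_pos m).ne'
  generalize √Real.pi * x / A N = k
  generalize Real.cos m + Real.cosh m = D at *
  push_cast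
  generalize Complex.sin m = p
  generalize Complex.sinh m = q
  generalize Complex.sin s = S
  generalize Complex.cos s = C
  generalize (a N s : ℂ) = α
  generalize (b N s : ℂ) = β
  have hI := Complex.I_sq
  field_simp
  linear_combination (-(p + q) - q * Complex.I
    + 2 * D * k * (S * β * Complex.I - S * α + C * β)) * hI

theorem approx_eq_explicit (N : ℕ) (x : ℝ) :
    approxC N x = explicitC N x ∧ approxS N x = explicitS N x := by
  unfold approxC approxS
  rw [CS_eq_explicit]
  simp

/-! ### Monotonicity and size of the constants -/

theorem A_strictMono : StrictMono A := fun M N h ↦ by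
  have hpi := Real.pi_pos
  refine lt_of_pow_lt_pow_left₀ 2 (A_pos N).le ?_
  rw [A_sq, A_sq]
  have : (M : ℝ) < N := by exact_mod_cast h
  nlinarith

theorem c_strictAnti : StrictAnti c := fun M N h ↦ by
  have hA := A_pos M
  have hlt := A_strictMono h
  have hpi := Real.pi_pos
  have hb := beta_pos
  have hsq : A M ^ 2 < A N ^ 2 := pow_lt_pow_left₀ hlt hA.le two_ne_zero
  have hDM := one_sub_exp_neg_pos M
  have hDN := one_sub_exp_neg_pos N
  have h1 : Real.exp (-2 * A N ^ 2) < Real.exp (-2 * A M ^ 2) := Real.exp_lt_exp.2 (by linarith)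
  have h2 : Real.exp (-beta * A N ^ 2) < Real.exp (-beta * A M ^ 2) :=
    Real.exp_lt_exp.2 (by nlinarith)
  unfold c
  gcongr

theorem cTilde_strictAnti : StrictAnti cTilde := fun M N h ↦ by
  have hA := A_pos M
  have hlt := A_strictMono h
  have hpi := Real.pi_pos
  have hsq : A M ^ 2 < A N ^ 2 := pow_lt_pow_left₀ hlt hA.le two_ne_zero
  have hDM := one_sub_exp_neg_pos M
  have hDN := one_sub_exp_neg_pos N
  have h1 : Real.exp (-2 * A N ^ 2) < Real.exp (-2 * A M ^ 2) := Real.exp_lt_exp.2 (by linarith)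
  unfold cTilde
  gcongr

theorem c_pos (N : ℕ) : 0 < c N := by
  have hA := A_pos N
  have hpi := Real.pi_pos
  have hD := one_sub_exp_neg_pos N
  unfold c
  positivity

theorem cTilde_pos (N : ℕ) : 0 < cTilde N := by
  have hA := A_pos N
  have hpi := Real.pi_pos
  have hD := one_sub_exp_neg_pos N
  unfold cTilde
  positivity

theorem A_one_sq : A 1 ^ 2 = 3 / 2 * Real.pi := by
  rw [A_sq]
  norm_num

theorem lt_A_one : 2.17 < A 1 := by
  refine lt_of_pow_lt_pow_left₀ 2 (A_pos 1).le ?_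
  rw [A_one_sq]
  linarith [Real.pi_gt_d4]

theorem lt_pi_rpow : 5.56 < Real.pi ^ (3 / 2 : ℝ) := by
  rw [pi_rpow_three_halves]
  have h : (1.772 : ℝ) < √Real.pi := by
    rw [Real.lt_sqrt (by norm_num)]
    linarith [Real.pi_gt_d4]
  nlinarith [Real.pi_gt_d4]

theorem lt_exp_pi_div_two : 4.8055 < Real.exp (Real.pi / 2) := by
  have h := Real.sum_le_exp_of_nonneg (show (0 : ℝ) ≤ 1.57 by norm_num) 12
  have h2 : Real.exp 1.57 ≤ Real.exp (Real.pi / 2) :=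
    Real.exp_le_exp.2 (by linarith [Real.pi_gt_d4])
  refine lt_of_lt_of_le ?_ (h.trans h2)
  norm_num [Finset.sum_range_succ, Nat.factorial]

theorem lt_one_sub_exp_A_one : 0.9997 < 1 - Real.exp (-2 * A 1 ^ 2) := by
  have h : Real.exp (-2 * A 1 ^ 2) ≤ Real.exp (-9) := by
    rw [A_one_sq]
    exact Real.exp_le_exp.2 (by linarith [Real.pi_gt_three])
  have h9 : (2.7 : ℝ) ^ 9 ≤ Real.exp 9 := by
    rw [show (9 : ℝ) = ((9 : ℕ) : ℝ) * 1 by norm_num, Real.exp_nat_mul]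
    exact pow_le_pow_left₀ (by norm_num) (by linarith [Real.exp_one_gt_d9]) 9
  have h' : Real.exp (-9) ≤ ((2.7 : ℝ) ^ 9)⁻¹ := by
    rw [Real.exp_neg]
    exact inv_anti₀ (by norm_num) h9
  have : ((2.7 : ℝ) ^ 9)⁻¹ < 0.0003 := by norm_num
  linarith

theorem exp_neg_beta_mul_lt : Real.exp (-beta * A 1 ^ 2) < 0.777 := by
  have hs : √2 < 1.41422 := by
    rw [Real.sqrt_lt' (by norm_num)]
    norm_num
  have hb : 0.05361 < beta := by
    unfold beta
    linarith
  -- 0.05361 · (3/2) · 3.1415 is just above 0.2526.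
  have h1 : 0.2526 ≤ beta * A 1 ^ 2 := by
    rw [A_one_sq]
    nlinarith [Real.pi_gt_d4]
  have h := Real.sum_le_exp_of_nonneg (show (0 : ℝ) ≤ 0.2526 by norm_num) 6
  have h2 : (1.2872 : ℝ) < Real.exp 0.2526 := by
    refine lt_of_lt_of_le ?_ h
    norm_num [Finset.sum_range_succ, Nat.factorial]
  rw [neg_mul, Real.exp_neg]
  have h3 : (1.2872 : ℝ) < Real.exp (beta * A 1 ^ 2) := h2.trans_le (Real.exp_le_exp.2 h1)
  have h4 := inv_strictAnti₀ (by norm_num) h3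
  refine h4.trans ?_
  norm_num

theorem cTilde_one_lt : cTilde 1 < 0.18 := by
  have h1 := lt_A_one
  have h2 := lt_pi_rpow
  have h3 := lt_exp_pi_div_two
  have h4 := lt_one_sub_exp_A_one
  have h5 := Real.pi_gt_d4
  have h6 := Real.pi_lt_d4
  have h7 := Real.pi_pos
  unfold cTilde
  calc _ ≤ (8 : ℝ) / (3 * 5.56 * 4.8055 * 0.9997)
          + (2 * 3.1416 + 1) / (3.1415 ^ 2 * 4.8055 * 2.17) := by
        gcongr
    _ < (0.18 : ℝ) := by norm_num

theorem c_one_lt : c 1 < 0.83 := by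
  have h1 := lt_A_one
  have h2 := lt_pi_rpow
  have h3 := lt_exp_pi_div_two
  have h4 := lt_one_sub_exp_A_one
  have h5 := Real.pi_gt_d4
  have h6 := Real.pi_lt_d4
  have h7 := Real.pi_pos
  have h8 := exp_neg_beta_mul_lt
  have hs : √2 < 1.41422 := by
    rw [Real.sqrt_lt' (by norm_num)]
    norm_num
  have hs' : 1.414 < √2 := by
    rw [Real.lt_sqrt (by norm_num)]
    norm_num
  have hp : √Real.pi < 1.7726 := by
    rw [Real.sqrt_lt' (by norm_num)]
    linarith
  have hE : Real.exp (-Real.pi / 2) < 0.2081 := by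
    rw [neg_div, Real.exp_neg]
    refine (inv_strictAnti₀ (by norm_num) h3).trans ?_
    norm_num
  unfold c
  -- The right side is about 0.826, so the enclosures leave little room.
  calc _ ≤ (20 : ℝ) * 1.41422 * 0.2081 / (9 * 3.1415 * 0.9997) * (1 + 2 * 1.7726 * 0.777)
          + (2 * 3.1416 + 1) * 0.2081 / (2 * 1.414 * 5.56 * 2.17) := by
        gcongr
    _ < (0.83 : ℝ) := by norm_num

end FresnelApprox

theorem mainTheorem8 :
    (∀ N : ℕ, 1 ≤ N → ∀ x : ℝ,
      FresnelApprox.approxC N x = FresnelApprox.explicitC N x ∧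
      FresnelApprox.approxS N x = FresnelApprox.explicitS N x) ∧
    (∀ N : ℕ, 1 ≤ N → ∀ x : ℝ,
      |FresnelApprox.fresnelC x - FresnelApprox.approxC N x|
          ≤ 2 * FresnelApprox.c N
            * (Real.exp (-Real.pi * (N : ℝ)) / Real.sqrt (2 * (N : ℝ) + 1)) ∧
      |FresnelApprox.fresnelS x - FresnelApprox.approxS N x|
          ≤ 2 * FresnelApprox.c N
            * (Real.exp (-Real.pi * (N : ℝ)) / Real.sqrt (2 * (N : ℝ) + 1))) ∧
    (∀ N : ℕ, 1 ≤ N → ∀ x : ℝ, |x| ≤ Real.sqrt ((N : ℝ) + 1 / 2) →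
      |FresnelApprox.fresnelC x - FresnelApprox.approxC N x|
          ≤ Real.sqrt Real.pi * FresnelApprox.cTilde N * |x|
            * (Real.exp (-Real.pi * (N : ℝ)) / (2 * (N : ℝ) + 1)) ∧
      |FresnelApprox.fresnelS x - FresnelApprox.approxS N x|
          ≤ Real.sqrt Real.pi * FresnelApprox.cTilde N * |x|
            * (Real.exp (-Real.pi * (N : ℝ)) / (2 * (N : ℝ) + 1))) ∧
    (∀ N : ℕ, 1 ≤ N →
      0 < FresnelApprox.c N ∧ FresnelApprox.c N < 0.83 ∧
      0 < FresnelApprox.cTilde N ∧ FresnelApprox.cTilde N < 0.18) ∧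
    StrictAntiOn FresnelApprox.c (Set.Ici 1) ∧
    StrictAntiOn FresnelApprox.cTilde (Set.Ici 1) := by
  refine ⟨fun N _ x ↦ FresnelApprox.approx_eq_explicit N x, fun N _ x ↦ ?_, fun N _ x _ ↦ ?_,
    fun N hN ↦ ?_, FresnelApprox.c_strictAnti.strictAntiOn _,
    FresnelApprox.cTilde_strictAnti.strictAntiOn _⟩
  · have h := FresnelApprox.norm_CS_sub_fresnel_le_c N x
    exact ⟨(FresnelApprox.abs_fresnelC_sub_le N x).trans h,
      (FresnelApprox.abs_fresnelS_sub_le N x).trans h⟩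
  · have h := FresnelApprox.norm_CS_sub_fresnel_le_cTilde N x
    exact ⟨(FresnelApprox.abs_fresnelC_sub_le N x).trans h,
      (FresnelApprox.abs_fresnelS_sub_le N x).trans h⟩
  · exact ⟨FresnelApprox.c_pos N,
      (FresnelApprox.c_strictAnti.antitone hN).trans_lt FresnelApprox.c_one_lt,
      FresnelApprox.cTilde_pos N,
      (FresnelApprox.cTilde_strictAnti.antitone hN).trans_lt FresnelApprox.cTilde_one_lt⟩
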